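/- **Setting.** For every $n$ let $1\le q_n\le p_n$ be integers, and let $(y_i,x_{i1},\dots,x_{ip_n})$, $i=1,\dots,n$, be independent observations of a centred Gaussian vector $(Y,X_1,\dots,X_{p_n})\sim N(0,\Sigma_n)$, where the covariance matrix $C^n$ of $(X_1,\dots,X_{p_n})$ has unit diagonal. Suppose that $y=X\beta+\varepsilon$, where $\beta\in\mathbb R^{p_n}$ and where the noise $\varepsilon\sim N(0,\sigma_n^2 I_n)$ is uncorrelated with $X=(x_{ij})$, and that $\beta_j\ne 0$ if and only if $j\le q_n$. Let $d_{jj}$ be the diagonal entries of $(C^n)^{-1}$. Let $\varepsilon_Y,\varepsilon_j$ be the errors of the best linear predictions of $Y$ and $X_j$ from $\{X_k:k\ne j\}$, let $\rho_j=\mathrm{Corr}(\varepsilon_Y,\varepsilon_j)$ and $s_j=\sqrt{\mathrm{Var}(\varepsilon_Y)}=\sqrt{\mathrm{Var}(Y\mid X_k,k\ne j)}$, and let $\gamma_j=\rho_js_j$ be the semi-standard partial covariance (SPAC) between $Y$ and $X_j$. Let $l_n>0$ satisfy $|\gamma_j|\ge l_n$ for all $j\le q_n$, and let $\lambda_n\ge0$.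 Let the design matrix $Z$ be either $X$ (for all $n$), or (for all $n$) the matrix obtained from $X$ by standardizing each column to mean $0$ and $Z_j^TZ_j=n$. For random vectors $\hat d=(\hat d_{11},\dots,\hat d_{p_np_n})$, a *SPAC-Lasso solution* is a global minimizer $\hat\gamma$ over $g\in\mathbb R^{p_n}$ of $$\frac12\Big\|y-\sum_{j=1}^{p_n}Z_j\sqrt{\hat d_{jj}}\,g_j\Big\|_2^2+\lambda_n\sum_{j=1}^{p_n}\hat d_{jj}|g_j| ,$$ and the corresponding coefficient estimator is $\hat\beta_j=\hat\gamma_j\sqrt{\hat d_{jj}}$. **Assumptions.** * (C1) There is $\eta>0$, independent of $n$, such that every entry of $\big|V(2)\,C^n_{21}(C^n_{11})^{-1}V(1)^{-1}\operatorname{sign}(\gamma_1,\dots,\gamma_{q_n})^T\big|$ is at most $1-\eta$. Here $C^n_{11}$ and $C^n_{21}$ are the blocks of $C^n$ with columns $1,\dots,q_n$ and with rows $1,\dots,q_n$ and $q_n+1,\dots,p_n$ respectively, and $V(1)=\mathrm{diag}(d_{jj}^{-1/2})_{j\le q_n}$, $V(2)=\mathrm{diag}(d_{jj}^{-1/2})_{j>q_n}$.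 * (C4) There are constants $0<c_1\le c_2<\infty$ such that all eigenvalues of $\Sigma_n$ lie in $[c_1,c_2]$ for all $n$. * (C5) For every $\delta>0$ there is $M>0$ such that $\max_{j\le p_n}|\hat d_{jj}-d_{jj}|\le M\sqrt{\log n/n}$ with probability at least $1-O(n^{-\delta})$ as $n\to\infty$. * $p_n=O(n^\kappa)$ for some $\kappa\ge0$, $q_n=o\big((n/\log n)^{1/3}\big)$, $\sqrt{q_nn\log n}=o(\lambda_n)$, $\sqrt{q_n}\lambda_n/n=o(1)$ and $\sqrt{q_n}\lambda_n/n=o(l_n)$ as $n\to\infty$. **Theorem.** There is a constant $K_0>0$ such that for every $\delta>0$ the following hold simultaneously with probability at least $1-O(n^{-\delta})$ as $n\to\infty$: 1. a SPAC-Lasso solution exists; 2. every SPAC-Lasso solution $\hat\gamma$ satisfies $\|\hat\gamma-\gamma\|_2\le K_0\sqrt{q_n}\,\lambda_n/n$, and the corresponding $\hat\beta$ satisfies $\|\hat\beta-\beta\|_2\le K_0\sqrt{q_n}\,\lambda_n/n$; 3. every SPAC-Lasso solution is sign consistent: $\operatorname{sign}(\hat\gamma_j)=\operatorname{sign}(\gamma_j)$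 for all $j\le p_n$. -/

import Mathlib

open MeasureTheory ProbabilityTheory Filter Asymptotics
open scoped NNReal

noncomputable section

namespace SPAC

/-! ### Population quantities

The covariance matrix of `(Y, X_1, …, X_p)` is indexed by `Option (Fin p)`: the index `none` is the
response `Y`, and the index `some j` is the covariate `X_j`. -/

/-- The covariance matrix `C` of the covariates. -/
def covX {p : ℕ} (S : Matrix (Option (Fin p)) (Option (Fin p)) ℝ) : Matrix (Fin p) (Fin p) ℝ :=
  S.submatrix some some

/-- The diagonal entries `d_jj` of the precision matrix `C⁻¹` of the covariates. -/
def precDiag {p : ℕ} (S : Matrix (Option (Fin p)) (Option (Fin p)) ℝ) (j : Fin p) : ℝ :=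
  (covX S)⁻¹ j j

/-- For a centred random vector `W` with covariance matrix `S`: the coefficients (with respect to
the coordinates of `W`) of the prediction error `W a - ∑ k ∈ T, w k * W k`, where the coefficients
`w = S_TT⁻¹ S_Ta` are those of the best linear prediction of `W a` from `(W k)`, `k ∈ T`. -/
def predError {ι : Type*} [Fintype ι] [DecidableEq ι] (S : Matrix ι ι ℝ) (T : Finset ι) (a : ι) :
    ι → ℝ := fun i =>
  (if i = a then 1 else 0) -
    (if h : i ∈ T then
      (((S.submatrix (fun k : T => (k : ι)) (fun k : T => (k : ι)))⁻¹).mulVec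
        (fun k : T => S k a)) ⟨i, h⟩
    else 0)

/-- The covariance of the linear forms `∑ u i * W i` and `∑ v i * W i` when `W` has covariance
matrix `S`. -/
def linCov {ι : Type*} [Fintype ι] (S : Matrix ι ι ℝ) (u v : ι → ℝ) : ℝ :=
  u ⬝ᵥ S.mulVec v

/-- The indices of the covariates `X_{-j} = {X_k : k ≠ j}`. -/
def others {p : ℕ} (j : Fin p) : Finset (Option (Fin p)) :=
  Finset.univ.filter fun i => i ≠ none ∧ i ≠ some j

/-- The covariance of the prediction errors of the coordinates `a` and `b` based on `X_{-j}`. -/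
def partialCov {p : ℕ} (S : Matrix (Option (Fin p)) (Option (Fin p)) ℝ) (j : Fin p)
    (a b : Option (Fin p)) : ℝ :=
  linCov S (predError S (others j) a) (predError S (others j) b)

/-- The partial correlation `ρ_j` between `Y` and `X_j`: the correlation of the prediction errors
of `Y` and of `X_j` based on `X_{-j}`. -/
def partialCorr {p : ℕ} (S : Matrix (Option (Fin p)) (Option (Fin p)) ℝ) (j : Fin p) : ℝ :=
  partialCov S j none (some j) /
    Real.sqrt (partialCov S j none none * partialCov S j (some j) (some j))

/-- The standard deviation `s_j` of `Y` given `X_{-j}`. -/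
def condSd {p : ℕ} (S : Matrix (Option (Fin p)) (Option (Fin p)) ℝ) (j : Fin p) : ℝ :=
  Real.sqrt (partialCov S j none none)

/-- The semi-standard partial covariance (SPAC) `γ_j = ρ_j s_j` between `Y` and `X_j`. -/
def spac {p : ℕ} (S : Matrix (Option (Fin p)) (Option (Fin p)) ℝ) (j : Fin p) : ℝ :=
  partialCorr S j * condSd S j

/-! ### The transformed irrepresentable vector -/

/-- The vector `V(2) C₂₁ C₁₁⁻¹ V(1)⁻¹ sign(γ(1))`, where the block `1` consists of the first `q`
covariates, the block `2` of the remaining ones, and `V = diag (√(1 / d_jj))`. -/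
def irrepVec {p : ℕ} (S : Matrix (Option (Fin p)) (Option (Fin p)) ℝ) (q : ℕ) :
    {j : Fin p // ¬ (j : ℕ) < q} → ℝ :=
  (Matrix.diagonal (fun j : {j : Fin p // ¬ (j : ℕ) < q} => Real.sqrt (1 / precDiag S j)) *
    (covX S).submatrix (fun j : {j : Fin p // ¬ (j : ℕ) < q} => (j : Fin p))
      (fun k : {k : Fin p // (k : ℕ) < q} => (k : Fin p)) *
    ((covX S).submatrix (fun k : {k : Fin p // (k : ℕ) < q} => (k : Fin p))
      (fun k : {k : Fin p // (k : ℕ) < q} => (k : Fin p)))⁻¹ *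
    (Matrix.diagonal
      (fun k : {k : Fin p // (k : ℕ) < q} => Real.sqrt (1 / precDiag S k)))⁻¹).mulVec
    (fun k => Real.sign (spac S k))

/-! ### The data -/

/-- The noise `ε = y - X β`. -/
def noise {n p : ℕ} (β : Fin p → ℝ) (X : Matrix (Fin n) (Fin p) ℝ) (y : Fin n → ℝ) (i : Fin n) :
    ℝ :=
  y i - ∑ j, X i j * β j

/-- The `i`-th observation `(y_i, x_i1, …, x_ip)`. -/
def obs {n p : ℕ} (X : Matrix (Fin n) (Fin p) ℝ) (y : Fin n → ℝ) (i : Fin n) :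
    EuclideanSpace ℝ (Option (Fin p)) :=
  WithLp.toLp 2 (fun o => o.elim (y i) (X i))

/-- `n` independent observations of `(Y, X_1, …, X_p) ∼ N(0, S)` that follow the linear model
`y = X β + ε` with noise `ε ∼ N(0, v I_n)` uncorrelated with `X`. -/
structure IsGaussianLinearModel {Ω : Type*} [MeasurableSpace Ω] (μ : Measure Ω) {n p : ℕ}
    (S : Matrix (Option (Fin p)) (Option (Fin p)) ℝ) (β : Fin p → ℝ) (v : ℝ≥0)
    (X : Ω → Matrix (Fin n) (Fin p) ℝ) (y : Ω → Fin n → ℝ) : Prop where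
  obs_law : ∀ i, HasLaw (fun ω => obs (X ω) (y ω) i) (multivariateGaussian 0 S) μ
  obs_indep : iIndepFun (fun i ω => obs (X ω) (y ω) i) μ
  noise_law : HasLaw (fun ω => noise β (X ω) (y ω)) (Measure.pi fun _ : Fin n => gaussianReal 0 v) μ
  noise_uncorr : ∀ i k j, cov[fun ω => noise β (X ω) (y ω) i, fun ω => X ω k j; μ] = 0

/-- The mean of the `j`-th column. -/
def colMean {n p : ℕ} (X : Matrix (Fin n) (Fin p) ℝ) (j : Fin p) : ℝ :=
  (∑ i, X i j) / n

/-- The standard deviation (with the factor `1 / n`) of the `j`-th column. -/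
def colSd {n p : ℕ} (X : Matrix (Fin n) (Fin p) ℝ) (j : Fin p) : ℝ :=
  Real.sqrt ((∑ i, (X i j - colMean X j) ^ 2) / n)

/-- The design matrix with standardized columns: each column `Z_j` has mean `0` and satisfies
`Z_jᵀ Z_j = n` (as long as the column `X_j` is not constant). -/
def standardize {n p : ℕ} (X : Matrix (Fin n) (Fin p) ℝ) : Matrix (Fin n) (Fin p) ℝ :=
  Matrix.of fun i j => (X i j - colMean X j) / colSd X j

/-! ### The estimator -/

/-- The SPAC-Lasso loss
`½ ‖y - ∑ j, Z_j √(d̂_j) g_j‖² + lam ∑ j, d̂_j |g_j|`. -/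
def lassoLoss {n p : ℕ} (lam : ℝ) (dhat : Fin p → ℝ) (Z : Matrix (Fin n) (Fin p) ℝ)
    (y : Fin n → ℝ) (g : Fin p → ℝ) : ℝ :=
  1 / 2 * ∑ i, (y i - ∑ j, Z i j * Real.sqrt (dhat j) * g j) ^ 2 + lam * ∑ j, dhat j * |g j|

/-- `g` is a SPAC-Lasso solution: a global minimizer of the SPAC-Lasso loss. -/
def IsLassoSolution {n p : ℕ} (lam : ℝ) (dhat : Fin p → ℝ) (Z : Matrix (Fin n) (Fin p) ℝ)
    (y : Fin n → ℝ) (g : Fin p → ℝ) : Prop :=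
  ∀ g' : Fin p → ℝ, lassoLoss lam dhat Z y g ≤ lassoLoss lam dhat Z y g'

/-- The estimator of the regression coefficients that corresponds to a SPAC vector `g`. -/
def betaOf {p : ℕ} (dhat g : Fin p → ℝ) (j : Fin p) : ℝ := g j * Real.sqrt (dhat j)

/-- The Euclidean norm of a vector. -/
def l2norm {p : ℕ} (v : Fin p → ℝ) : ℝ := ‖(WithLp.toLp 2 v : EuclideanSpace ℝ (Fin p))‖

/-! ### Probability statements and regularity conditions -/

/-- The events `E n` hold with probability at least `1 - O(n^(-δ))` as `n → ∞`. -/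
def HoldsWithRate {Ω : ℕ → Type*} [∀ n, MeasurableSpace (Ω n)] (μ : ∀ n, Measure (Ω n)) (δ : ℝ)
    (E : ∀ n, Ω n → Prop) : Prop :=
  (fun n => (μ n).real {ω | ¬ E n ω}) =O[atTop] fun n : ℕ => (n : ℝ) ^ (-δ)

/-- The covariance matrices have eigenvalues bounded away from zero and infinity. -/
def EigenvaluesBounded {p : ℕ → ℕ} (S : ∀ n, Matrix (Option (Fin (p n))) (Option (Fin (p n))) ℝ) :
    Prop :=
  ∃ c₁ c₂ : ℝ, 0 < c₁ ∧ c₁ ≤ c₂ ∧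
    ∀ n, ∃ h : (S n).IsHermitian, ∀ i, c₁ ≤ h.eigenvalues i ∧ h.eigenvalues i ≤ c₂

/-- The estimator `d̂` of the diagonal of the precision matrix is accurate at the rate
`√(log n / n)`. -/
def PrecisionAccurate {Ω : ℕ → Type*} [∀ n, MeasurableSpace (Ω n)] (μ : ∀ n, Measure (Ω n))
    {p : ℕ → ℕ} (S : ∀ n, Matrix (Option (Fin (p n))) (Option (Fin (p n))) ℝ)
    (dhat : ∀ n, Ω n → Fin (p n) → ℝ) : Prop :=
  ∀ δ : ℝ, 0 < δ → ∃ M : ℝ, 0 < M ∧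
    HoldsWithRate μ δ fun n ω =>
      ∀ i, |dhat n ω i - precDiag (S n) i| ≤ M * Real.sqrt (Real.log n / n)

/-- The transformed strong irrepresentable condition, with a margin `η` that does not depend
on `n`. -/
def StrongIrrepresentable {p : ℕ → ℕ} (q : ℕ → ℕ)
    (S : ∀ n, Matrix (Option (Fin (p n))) (Option (Fin (p n))) ℝ) : Prop :=
  ∃ η : ℝ, 0 < η ∧ ∀ n j, |irrepVec (S n) (q n) j| ≤ 1 - η

end SPAC

end

/-! Because the noise is uncorrelated with the covariates, `γ_j = β_j / √d_jj` (`spac_eq`). In the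
variables `b_j = √d̂_jj g_j` the problem is therefore a Lasso for `β` with penalty weights `√d̂_jj`.
The proof is a primal-dual witness argument with a probabilistic and a deterministic half.

Probability: outside an event of probability `O(n^(-δ))`, all empirical first and second moments of
covariates and noise are within order `√(log n / n)` of their population values. This is
`measure_not_momentsAccurate_le`: Chernoff bounds for Gaussian squares, polarization for products,
and a union bound over polynomially many pairs. `MomentsAccurate.exists_scale` carries this over to
the standardized design, where the target becomes `t_j β_j` with `t_j` the column standard
deviation.

Determinism: `exists_restricted_solution` solves the stationarity equation on the active coordinates
with the signs of `β` prescribed. The active Gram matrix is coercive, so the correction to the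
target has norm `O(√q λ/n)`, which is too small to change a sign. On the inactive coordinates the
gradient is `λ/n` times the irrepresentable expression, up to an arbitrarily small multiple of
`λ/n`, so the margin `η` gives strict dual feasibility. The smallness comes from `q^(3/2) √(log n /
n) → 0` and `√q √(log n / n) = o(λ/n)`.

Strict feasibility makes the witness the unique minimizer (`isLassoSolution_iff_eq`), so existence,
error bounds and signs are all read off from one explicit vector in `exists_unique_lassoSolution`.
-/

namespace SPAC

/-! ### Concentration of Gaussian sums -/

section Concentration

variable {Ω : Type*} [MeasurableSpace Ω] {μ : Measure Ω}

theorem integrable_exp_mul_sum {ι : Type*} {T : ι → Ω → ℝ} (hT : ∀ i, AEMeasurable (T i) μ)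
    (hind : iIndepFun T μ) {s : ℝ} (hint : ∀ i, Integrable (fun ω => Real.exp (s * T i ω)) μ)
    (A : Finset ι) : Integrable (fun ω => Real.exp (s * (∑ i ∈ A, T i) ω)) μ := by
  classical
  have := hind.isProbabilityMeasure
  induction A using Finset.induction_on with
  | empty => simp
  | insert i A hi ih =>
    rw [Finset.sum_insert hi]
    exact IndepFun.integrable_exp_mul_add (hind.indepFun_finsetSum_of_notMem₀ hT hi).symm
      (hint i) ih

/-- A two-sided Chernoff bound for sums of independent random variables. -/
theorem measure_abs_sum_ge_le {n : ℕ} {T : Fin n → Ω → ℝ} (hT : ∀ i, AEMeasurable (T i) μ)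
    (hind : iIndepFun T μ) {t b y : ℝ} (ht : 0 ≤ t)
    (hint : ∀ i, ∀ s : ℝ, |s| = t →
      Integrable (fun ω => Real.exp (s * T i ω)) μ ∧ mgf (T i) μ s ≤ Real.exp b) :
    μ.real {ω | n * y ≤ |∑ i, T i ω|} ≤ 2 * Real.exp (-(n * (t * y - b))) := by
  have := hind.isProbabilityMeasure
  have hmgf : ∀ s : ℝ, |s| = t → mgf (∑ i, T i) μ s ≤ Real.exp (n * b) := by
    intro s hs
    rw [hind.mgf_sum₀ hT]
    calc ∏ i, mgf (T i) μ s ≤ ∏ _i : Fin n, Real.exp b :=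
          Finset.prod_le_prod (fun i _ => mgf_nonneg) fun i _ => (hint i s hs).2
      _ = Real.exp (n * b) := by simp [← Real.exp_nat_mul]
  have hsum : ∀ s : ℝ, |s| = t →
      Integrable (fun ω => Real.exp (s * (∑ i, T i) ω)) μ :=
    fun s hs => integrable_exp_mul_sum hT hind (fun i => (hint i s hs).1) _
  have h1 : μ.real {ω | n * y ≤ (∑ i, T i) ω} ≤ Real.exp (-(n * (t * y - b))) := by
    refine (measure_ge_le_exp_mul_mgf _ ht (hsum t (abs_of_nonneg ht))).trans ?_
    refine (mul_le_mul_of_nonneg_left (hmgf t (abs_of_nonneg ht)) (Real.exp_nonneg _)).trans ?_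
    rw [← Real.exp_add]
    exact le_of_eq (by ring_nf)
  have h2 : μ.real {ω | (∑ i, T i) ω ≤ -(n * y)} ≤ Real.exp (-(n * (t * y - b))) := by
    have hs : |(-t)| = t := by rw [abs_neg, abs_of_nonneg ht]
    refine (measure_le_le_exp_mul_mgf _ (neg_nonpos.2 ht) (hsum (-t) hs)).trans ?_
    refine (mul_le_mul_of_nonneg_left (hmgf (-t) hs) (Real.exp_nonneg _)).trans ?_
    rw [← Real.exp_add]
    exact le_of_eq (by ring_nf)
  calc μ.real {ω | n * y ≤ |∑ i, T i ω|}
      ≤ μ.real ({ω | n * y ≤ (∑ i, T i) ω} ∪ {ω | (∑ i, T i) ω ≤ -(n * y)}) := by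
        refine measureReal_mono fun ω hω => ?_
        simp only [Set.mem_ofPred_eq, Set.mem_union, Finset.sum_apply] at hω ⊢
        rcases le_abs.1 hω with h | h
        · exact Or.inl h
        · exact Or.inr (by linarith)
    _ ≤ _ := (measureReal_union_le _ _).trans (by linarith)

/-- Multiplying the standard Gaussian density by `exp (t x²)` leaves an unnormalized Gaussian with
rate `1/2 - t`. -/
theorem integral_exp_mul_sq_gaussianReal {t : ℝ} (ht : t < 1 / 2) :
    Integrable (fun x => Real.exp (t * x ^ 2)) (gaussianReal 0 1) ∧
      ∫ x, Real.exp (t * x ^ 2) ∂(gaussianReal 0 1) = (Real.sqrt (1 - 2 * t))⁻¹ := by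
  have hb : 0 < 1 / 2 - t := by linarith
  have hden : ∀ x : ℝ, gaussianPDFReal 0 1 x * Real.exp (t * x ^ 2) =
      (Real.sqrt (2 * Real.pi))⁻¹ * Real.exp (-(1 / 2 - t) * x ^ 2) := by
    intro x
    rw [gaussianPDFReal, mul_assoc, ← Real.exp_add]
    simp only [NNReal.coe_one, mul_one, sub_zero]
    ring_nf
  constructor
  · rw [gaussianReal_of_var_ne_zero _ one_ne_zero,
      integrable_withDensity_iff_integrable_smul₀' (measurable_gaussianPDF 0 1).aemeasurable
        (ae_of_all _ fun x => by simp [gaussianPDF])]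
    simp only [toReal_gaussianPDF, smul_eq_mul, hden]
    exact (integrable_exp_neg_mul_sq hb).const_mul _
  · rw [integral_gaussianReal_eq_integral_smul one_ne_zero]
    simp only [smul_eq_mul, hden]
    rw [integral_const_mul, integral_gaussian, ← Real.sqrt_inv, ← Real.sqrt_inv,
      ← Real.sqrt_mul (by positivity)]
    congr 1
    have : (1 - 2 * t) ≠ 0 := by linarith
    have := Real.pi_ne_zero
    field_simp

/-- Taylor expansion of `-½ log (1 - 2t)`: the linear term is `t`, and for `|2t| ≤ 1/2` the
remainder of the logarithm is at most `8t²`, which is then halved. -/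
theorem inv_sqrt_one_sub_le {t : ℝ} (ht : |t| ≤ 1 / 4) :
    (Real.sqrt (1 - 2 * t))⁻¹ ≤ Real.exp (t + 4 * t ^ 2) := by
  have hs : |2 * t| ≤ 1 / 2 := by rw [abs_mul, abs_two]; linarith
  have hpos : 0 < 1 - 2 * t := by linarith [le_abs_self (2 * t)]
  have hlog := Real.abs_log_sub_add_sum_range_le (x := 2 * t) (by linarith) 1
  have h2 : |2 * t| ^ (1 + 1) / (1 - |2 * t|) ≤ 8 * t ^ 2 := by
    rw [div_le_iff₀ (by linarith)]
    have h1 : (2 : ℝ)⁻¹ ≤ 1 - |2 * t| := by linarith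
    calc |2 * t| ^ (1 + 1) = 8 * t ^ 2 * (2 : ℝ)⁻¹ := by rw [← sq_abs t, abs_mul, abs_two]; ring
      _ ≤ _ := mul_le_mul_of_nonneg_left h1 (by positivity)
  have h3 : -(2 * t) - 8 * t ^ 2 ≤ Real.log (1 - 2 * t) := by
    have := neg_le_of_abs_le (hlog.trans h2)
    simp at this
    linarith
  rw [← Real.exp_log (Real.sqrt_pos.2 hpos), ← Real.exp_neg, Real.exp_le_exp,
    Real.log_sqrt hpos.le]
  linarith

/-- After rescaling to unit variance, centring cancels the linear term of the exponent. What is left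
is quadratic in `t`, the sub-exponential bound that Chernoff needs. -/
theorem mgf_sq_sub_gaussianReal {v : ℝ≥0} {t : ℝ} (ht : |t * v| ≤ 1 / 4) :
    Integrable (fun x => Real.exp (t * (x ^ 2 - v))) (gaussianReal 0 v) ∧
      ∫ x, Real.exp (t * (x ^ 2 - v)) ∂(gaussianReal 0 v) ≤ Real.exp (4 * (t * v) ^ 2) := by
  have hmap : gaussianReal 0 v = (gaussianReal 0 1).map (Real.sqrt v * ·) := by
    rw [gaussianReal_map_const_mul]
    congr 1
    · simp
    · ext; simp
  have hmeas : Measurable (fun x : ℝ => Real.sqrt v * x) := by fun_prop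
  have hmeas' : Measurable (fun x : ℝ => Real.exp (t * (x ^ 2 - v))) := by fun_prop
  have hcomp : ∀ x : ℝ, Real.exp (t * ((Real.sqrt v * x) ^ 2 - v)) =
      Real.exp (-(t * v)) * Real.exp ((t * v) * x ^ 2) := by
    intro x
    rw [mul_pow, Real.sq_sqrt v.coe_nonneg, ← Real.exp_add]
    ring_nf
  obtain ⟨h1, h2⟩ := integral_exp_mul_sq_gaussianReal
    (t := t * v) (by linarith [le_abs_self (t * v)])
  rw [hmap]
  constructor
  · rw [integrable_map_measure hmeas'.aestronglyMeasurable hmeas.aemeasurable]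
    simp only [Function.comp_def, hcomp]
    exact h1.const_mul _
  · rw [integral_map hmeas.aemeasurable hmeas'.aestronglyMeasurable]
    simp only [hcomp]
    rw [integral_const_mul, h2]
    refine (mul_le_mul_of_nonneg_left (inv_sqrt_one_sub_le ht) (Real.exp_nonneg _)).trans ?_
    rw [← Real.exp_add]
    exact le_of_eq (by ring_nf)

variable {n : ℕ} {L : Fin n → Ω → ℝ} {v : ℝ≥0} {V x : ℝ}

/-- Concentration of the empirical second moment of independent centred Gaussian variables. -/
theorem measure_abs_sum_sq_sub_ge_le (hind : iIndepFun L μ)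
    (hL : ∀ i, HasLaw (L i) (gaussianReal 0 v) μ) (hv : (v : ℝ) ≤ V) (hV : 1 ≤ V) (hx : 0 ≤ x)
    (hx2 : x ≤ 2) :
    μ.real {ω | n * (V * x) ≤ |∑ i, (L i ω ^ 2 - v)|} ≤ 2 * Real.exp (-(n * x ^ 2 / 16)) := by
  have hV0 : 0 < V := by linarith
  have hv0 : (0 : ℝ) ≤ v := v.2
  have hsq : Measurable fun z : ℝ => z ^ 2 - (v : ℝ) := by fun_prop
  -- With `t = x / (8V)` and `x ≤ 2` one has `|t v| ≤ x/8 ≤ 1/4`, so the moment bound applies with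
  -- `b = 4 (x/8)² = x²/16`. The exponent is `t V x - b = x²/8 - x²/16`.
  have key := measure_abs_sum_ge_le (μ := μ) (T := fun i ω => L i ω ^ 2 - v) (t := x / (8 * V))
    (b := x ^ 2 / 16) (y := V * x) (fun i => hsq.comp_aemeasurable (hL i).aemeasurable)
    (hind.comp (fun _ z => z ^ 2 - (v : ℝ)) fun _ => hsq) (by positivity) ?_
  · refine key.trans (le_of_eq ?_)
    congr 3
    field_simp
    ring
  · intro i s hs
    have hsv : |s * v| ≤ x / 8 := by
      rw [abs_mul, hs, abs_of_nonneg hv0, div_mul_eq_mul_div, div_le_div_iff₀ (by positivity)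
        (by norm_num)]
      nlinarith [mul_le_mul_of_nonneg_left hv hx]
    obtain ⟨h1, h2⟩ := mgf_sq_sub_gaussianReal (v := v) (t := s) (by linarith)
    have hm : AEStronglyMeasurable (fun z : ℝ => Real.exp (s * (z ^ 2 - v)))
        (μ.map (L i)) := (by fun_prop : Measurable _).aestronglyMeasurable
    rw [← (hL i).map_eq] at h1 h2
    refine ⟨(integrable_map_measure hm (hL i).aemeasurable).1 h1, ?_⟩
    rw [integral_map (hL i).aemeasurable hm] at h2
    refine h2.trans (Real.exp_le_exp.2 ?_)
    nlinarith [sq_abs (s * v), abs_nonneg (s * v)]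

/-- Concentration of the sample mean of independent centred Gaussian variables. -/
theorem measure_abs_sum_ge_le_of_gaussianReal (hind : iIndepFun L μ)
    (hL : ∀ i, HasLaw (L i) (gaussianReal 0 v) μ) (hv : (v : ℝ) ≤ V) (hV : 1 ≤ V) (hx : 0 ≤ x) :
    μ.real {ω | n * (V * x) ≤ |∑ i, L i ω|} ≤ 2 * Real.exp (-(n * x ^ 2 / 16)) := by
  have key := measure_abs_sum_ge_le (μ := μ) (T := L) (t := x)
    (b := V * x ^ 2 / 2) (y := V * x) (fun i => (hL i).aemeasurable) hind hx ?_
  · refine key.trans ?_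
    -- The available exponent `V x² / 2` is weakened to the one for second moments, so that a single
    -- tail serves the union bound.
    have h1 : x ^ 2 / 16 ≤ x * (V * x) - V * x ^ 2 / 2 := by nlinarith [sq_nonneg x]
    have h2 := mul_le_mul_of_nonneg_left h1 n.cast_nonneg
    gcongr
    linarith
  · intro i s hs
    have hs2 : s ^ 2 = x ^ 2 := by rw [← hs, sq_abs]
    constructor
    · have h1 := integrable_exp_mul_gaussianReal (μ := 0) (v := v) s
      rw [← (hL i).map_eq] at h1
      exact (integrable_map_measure ((by fun_prop : Measurable _).aestronglyMeasurable)
        (hL i).aemeasurable).1 h1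
    · rw [mgf_gaussianReal (hL i).map_eq]
      refine Real.exp_le_exp.2 ?_
      nlinarith [sq_nonneg x]

end Concentration

theorem isSymm_of_posSemidef {ι : Type*} {S : Matrix ι ι ℝ} (hS : S.PosSemidef) : S.IsSymm := by
  simpa [Matrix.IsHermitian, Matrix.IsSymm] using hS.1

/-! ### Covariances and laws of linear forms in a Gaussian vector -/

section LinearForms

variable {ι : Type*} [Fintype ι] {S : Matrix ι ι ℝ}

theorem linCov_add_left (S : Matrix ι ι ℝ) (u u' v : ι → ℝ) :
    linCov S (u + u') v = linCov S u v + linCov S u' v := add_dotProduct _ _ _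

theorem linCov_add_right (S : Matrix ι ι ℝ) (u v v' : ι → ℝ) :
    linCov S u (v + v') = linCov S u v + linCov S u v' := by
  simp [linCov, Matrix.mulVec_add, dotProduct_add]

theorem linCov_sub_left (S : Matrix ι ι ℝ) (u u' v : ι → ℝ) :
    linCov S (u - u') v = linCov S u v - linCov S u' v := sub_dotProduct _ _ _

theorem linCov_sub_right (S : Matrix ι ι ℝ) (u v v' : ι → ℝ) :
    linCov S u (v - v') = linCov S u v - linCov S u v' := by
  simp [linCov, Matrix.mulVec_sub, dotProduct_sub]

theorem linCov_comm (hS : S.IsSymm) (u v : ι → ℝ) : linCov S u v = linCov S v u := by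
  rw [linCov, linCov, Matrix.dotProduct_mulVec, ← Matrix.mulVec_transpose, hS.eq, dotProduct_comm]

theorem linCov_self_nonneg (hS : S.PosSemidef) (u : ι → ℝ) : 0 ≤ linCov S u u := by
  simpa [linCov] using hS.dotProduct_mulVec_nonneg u

/-- The linear form `∑ u o * x o` as a continuous linear functional. -/
noncomputable def linForm (u : ι → ℝ) : StrongDual ℝ (EuclideanSpace ℝ ι) := innerSL ℝ (WithLp.toLp 2 u)

theorem linForm_apply (u : ι → ℝ) (x : EuclideanSpace ℝ ι) : linForm u x = ∑ o, u o * x o := by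
  simp [linForm, PiLp.inner_apply, mul_comm]

variable [DecidableEq ι]

theorem cov_linForm (hS : S.PosSemidef) (u v : ι → ℝ) :
    cov[fun x => linForm u x, fun x => linForm v x; multivariateGaussian 0 S] = linCov S u v := by
  have h := covarianceBilin_multivariateGaussian (μ := 0) hS (WithLp.toLp 2 u) (WithLp.toLp 2 v)
  rw [covarianceBilin_apply_eq_cov IsGaussian.memLp_two_id] at h
  exact h

theorem hasLaw_linForm (hS : S.PosSemidef) (u : ι → ℝ) :
    HasLaw (fun x => linForm u x) (gaussianReal 0 (linCov S u u).toNNReal)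
      (multivariateGaussian 0 S) where
  aemeasurable := by fun_prop
  map_eq := by
    have h : Var[fun x => linForm u x; multivariateGaussian 0 S] = linCov S u u := by
      rw [← covariance_self (by fun_prop), cov_linForm hS]
    have h0 : ∫ x, linForm u x ∂(multivariateGaussian 0 S) = 0 := by
      rw [ContinuousLinearMap.integral_comp_id_comm IsGaussian.integrable_id]
      simp
    rw [IsGaussian.map_eq_gaussianReal, h, h0]

end LinearForms

/-! ### Empirical moments of the observations -/

section Observations

variable {Ω : Type*} [MeasurableSpace Ω] {μ : Measure Ω} {n p : ℕ}
  {S : Matrix (Option (Fin p)) (Option (Fin p)) ℝ} {β : Fin p → ℝ} {v : ℝ≥0}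
  {X : Ω → Matrix (Fin n) (Fin p) ℝ} {y : Ω → Fin n → ℝ}

/-- The coefficients of the noise as a linear form in `(Y, X_1, …, X_p)`. -/
noncomputable def noiseCoef (β : Fin p → ℝ) (o : Option (Fin p)) : ℝ := o.elim 1 fun j => -β j

theorem linForm_single_obs (X : Matrix (Fin n) (Fin p) ℝ) (y : Fin n → ℝ) (i : Fin n)
    (j : Fin p) : linForm (Pi.single (some j) 1) (obs X y i) = X i j := by
  simp [linForm_apply, obs, Pi.single_apply]

theorem linForm_noiseCoef_obs (β : Fin p → ℝ) (X : Matrix (Fin n) (Fin p) ℝ) (y : Fin n → ℝ)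
    (i : Fin n) : linForm (noiseCoef β) (obs X y i) = noise β X y i := by
  simp [linForm_apply, obs, noiseCoef, noise, Fintype.sum_option, mul_comm, sub_eq_add_neg]

theorem IsGaussianLinearModel.hasLaw_linForm_obs (h : IsGaussianLinearModel μ S β v X y)
    (hS : S.PosSemidef) (u : Option (Fin p) → ℝ) (i : Fin n) :
    HasLaw (fun ω => linForm u (obs (X ω) (y ω) i)) (gaussianReal 0 (linCov S u u).toNNReal) μ :=
  (hasLaw_linForm hS u).comp (h.obs_law i)

theorem IsGaussianLinearModel.iIndepFun_linForm_obs (h : IsGaussianLinearModel μ S β v X y)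
    (u : Option (Fin p) → ℝ) : iIndepFun (fun i ω => linForm u (obs (X ω) (y ω) i)) μ :=
  h.obs_indep.comp (fun _ x => linForm u x) fun _ => by fun_prop

/-- The covariates are uncorrelated with the noise at the population level. -/
theorem IsGaussianLinearModel.linCov_noiseCoef (h : IsGaussianLinearModel μ S β v X y)
    (hS : S.PosSemidef) (hn : 0 < n) (j : Fin p) :
    linCov S (noiseCoef β) (Pi.single (some j) 1) = 0 := by
  -- The hypothesis concerns the sample. A single observation, which exists since `n > 0`, has law
  -- `N(0, S)` and transfers it to the population.
  have h0 := h.noise_uncorr ⟨0, hn⟩ ⟨0, hn⟩ j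
  have hlaw := h.obs_law ⟨0, hn⟩
  rw [← cov_linForm hS, ← hlaw.map_eq, covariance_map (by fun_prop) (by fun_prop)
    hlaw.aemeasurable]
  simpa only [Function.comp_def, linForm_single_obs, linForm_noiseCoef_obs] using h0

variable {V x : ℝ}

theorem IsGaussianLinearModel.measure_abs_sum_linForm_ge_le
    (h : IsGaussianLinearModel μ S β v X y) (hS : S.PosSemidef) (u : Option (Fin p) → ℝ)
    (hu : linCov S u u ≤ V) (hV : 1 ≤ V) (hx : 0 ≤ x) :
    μ.real {ω | n * (V * x) ≤ |∑ i, linForm u (obs (X ω) (y ω) i)|} ≤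
      2 * Real.exp (-(n * x ^ 2 / 16)) := by
  refine measure_abs_sum_ge_le_of_gaussianReal (h.iIndepFun_linForm_obs u)
    (h.hasLaw_linForm_obs hS u) ?_ hV hx
  rwa [Real.coe_toNNReal _ (linCov_self_nonneg hS u)]

/-- Concentration of the empirical covariance of two linear forms. -/
theorem IsGaussianLinearModel.measure_abs_sum_linForm_mul_ge_le
    (h : IsGaussianLinearModel μ S β v X y) (hS : S.PosSemidef) {u u' : Option (Fin p) → ℝ}
    (hu : 4 * linCov S u u ≤ V) (hu' : 4 * linCov S u' u' ≤ V) (hV : 1 ≤ V) (hx : 0 ≤ x)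
    (hx2 : x ≤ 2) :
    μ.real {ω | n * (V * x) ≤
        |∑ i, linForm u (obs (X ω) (y ω) i) * linForm u' (obs (X ω) (y ω) i) -
          n * linCov S u u'|} ≤
      4 * Real.exp (-(n * x ^ 2 / 16)) := by
  have := h.obs_indep.isProbabilityMeasure
  have hsymm := linCov_comm (isSymm_of_posSemidef hS) u' u
  -- Polarization: a product is a quarter of the difference of the squares of `u + u'` and `u - u'`.
  -- Their variances are at most `2 Var u + 2 Var u' ≤ V`, which explains the factor 4 in the
  -- hypotheses.
  have hadd : linCov S (u + u') (u + u') =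
      linCov S u u + linCov S u' u' + 2 * linCov S u u' := by
    rw [linCov_add_left, linCov_add_right, linCov_add_right, hsymm]; ring
  have hsub : linCov S (u - u') (u - u') =
      linCov S u u + linCov S u' u' - 2 * linCov S u u' := by
    rw [linCov_sub_left, linCov_sub_right, linCov_sub_right, hsymm]; ring
  have hadd0 := linCov_self_nonneg hS (u + u')
  have hsub0 := linCov_self_nonneg hS (u - u')
  have h1 := measure_abs_sum_sq_sub_ge_le (h.iIndepFun_linForm_obs (u + u'))
    (h.hasLaw_linForm_obs hS (u + u'))
    (by rw [Real.coe_toNNReal _ hadd0]; linarith) hV hx hx2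
  have h2 := measure_abs_sum_sq_sub_ge_le (h.iIndepFun_linForm_obs (u - u'))
    (h.hasLaw_linForm_obs hS (u - u'))
    (by rw [Real.coe_toNNReal _ hsub0]; linarith) hV hx hx2
  rw [Real.coe_toNNReal _ hadd0] at h1
  rw [Real.coe_toNNReal _ hsub0] at h2
  refine (measureReal_mono ?_).trans ((measureReal_union_le _ _).trans
    ((add_le_add h1 h2).trans (by linarith)))
  intro ω hω
  simp only [Set.mem_ofPred_eq, Set.mem_union] at hω ⊢
  by_contra! hcon
  obtain ⟨ha, hb⟩ := hcon
  have hid : 4 * (∑ i, linForm u (obs (X ω) (y ω) i) * linForm u' (obs (X ω) (y ω) i) -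
        n * linCov S u u') =
      ∑ i, (linForm (u + u') (obs (X ω) (y ω) i) ^ 2 - linCov S (u + u') (u + u')) -
      ∑ i, (linForm (u - u') (obs (X ω) (y ω) i) ^ 2 - linCov S (u - u') (u - u')) := by
    have hl : ∀ z, linForm (u + u') z = linForm u z + linForm u' z := fun z => by
      simp [linForm_apply, add_mul, Finset.sum_add_distrib]
    have hl' : ∀ z, linForm (u - u') z = linForm u z - linForm u' z := fun z => by
      simp [linForm_apply, sub_mul, Finset.sum_sub_distrib]
    have hc : (n : ℝ) * linCov S u u' = ∑ _i : Fin n, linCov S u u' := by simp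
    rw [hc, ← Finset.sum_sub_distrib, ← Finset.sum_sub_distrib, Finset.mul_sum]
    refine Finset.sum_congr rfl fun i _ => ?_
    rw [hl, hl', hadd, hsub]
    ring
  have hnx : 0 ≤ (n : ℝ) * (V * x) := by positivity
  have := abs_sub (∑ i, (linForm (u + u') (obs (X ω) (y ω) i) ^ 2 - linCov S (u + u') (u + u')))
    (∑ i, (linForm (u - u') (obs (X ω) (y ω) i) ^ 2 - linCov S (u - u') (u - u')))
  rw [← hid, abs_mul, abs_of_pos (by norm_num : (0 : ℝ) < 4)] at this
  linarith

/-- The empirical first and second moments of covariates and noise are within `a` of their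
population values. -/
structure MomentsAccurate (C : Matrix (Fin p) (Fin p) ℝ) (β : Fin p → ℝ)
    (X : Matrix (Fin n) (Fin p) ℝ) (y : Fin n → ℝ) (a : ℝ) : Prop where
  gram : ∀ j k, |∑ i, X i j * X i k - n * C j k| ≤ n * a
  cross : ∀ j, |∑ i, X i j * noise β X y i| ≤ n * a
  mean : ∀ j, |∑ i, X i j| ≤ n * a
  mean_noise : |∑ i, noise β X y i| ≤ n * a

/-- Union bound over the `p + 1` forms consisting of the noise and the covariates: `(p+1)²` products
with tail factor 4 and `p + 1` means with tail factor 2. -/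
theorem IsGaussianLinearModel.measure_not_momentsAccurate_le
    (h : IsGaussianLinearModel μ S β v X y) (hS : S.PosSemidef) (hn : 0 < n)
    (hX : ∀ j, 4 * covX S j j ≤ V)
    (hε : 4 * linCov S (noiseCoef β) (noiseCoef β) ≤ V) (hV : 1 ≤ V) (hx : 0 ≤ x)
    (hx2 : x ≤ 2) :
    μ.real {ω | ¬ MomentsAccurate (covX S) β (X ω) (y ω) (V * x)} ≤
      6 * ((p : ℝ) + 1) ^ 2 * Real.exp (-(n * x ^ 2 / 16)) := by
  have := h.obs_indep.isProbabilityMeasure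
  set F : Option (Fin p) → Option (Fin p) → ℝ :=
    fun o => o.elim (noiseCoef β) fun j => Pi.single (some j) 1 with hF
  have hcov : ∀ j k, linCov S (F (some j)) (F (some k)) = covX S j k := by
    intro j k
    simp [hF, linCov, covX]
  have hFV : ∀ o, 4 * linCov S (F o) (F o) ≤ V := by
    rintro (_ | j)
    · exact hε
    · rw [hcov]; exact hX j
  set E := Real.exp (-(n * x ^ 2 / 16)) with hE
  have hE0 : 0 < E := Real.exp_pos _
  set A : Option (Fin p) × Option (Fin p) → Set Ω := fun o => {ω | n * (V * x) ≤
    |∑ i, linForm (F o.1) (obs (X ω) (y ω) i) * linForm (F o.2) (obs (X ω) (y ω) i) -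
      n * linCov S (F o.1) (F o.2)|} with hA
  set B : Option (Fin p) → Set Ω := fun o => {ω | n * (V * x) ≤
    |∑ i, linForm (F o) (obs (X ω) (y ω) i)|} with hB
  have hAle : ∀ o, μ.real (A o) ≤ 4 * E := fun o =>
    h.measure_abs_sum_linForm_mul_ge_le hS (hFV _) (hFV _) hV hx hx2
  have hBle : ∀ o, μ.real (B o) ≤ 2 * E := fun o =>
    h.measure_abs_sum_linForm_ge_le hS _
      (by linarith [hFV o, linCov_self_nonneg hS (F o)]) hV hx
  have hsub : {ω | ¬ MomentsAccurate (covX S) β (X ω) (y ω) (V * x)} ⊆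
      (⋃ o, A o) ∪ ⋃ o, B o := by
    intro ω hω
    by_contra hcon
    simp only [Set.mem_union, Set.mem_iUnion, not_or, not_exists, hA, hB, Set.mem_ofPred_eq,
      not_le] at hcon
    obtain ⟨h1, h2⟩ := hcon
    refine hω ⟨fun j k => ?_, fun j => ?_, fun j => ?_, ?_⟩
    · have := h1 (some j, some k)
      rw [hcov] at this
      simpa only [hF, Option.elim, linForm_single_obs] using this.le
    · have := h1 (none, some j)
      have h0 : linCov S (F none) (F (some j)) = 0 := h.linCov_noiseCoef hS hn j
      rw [h0] at this
      simpa only [hF, Option.elim, linForm_single_obs, linForm_noiseCoef_obs, mul_zero, sub_zero,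
        mul_comm (noise _ _ _ _)] using this.le
    · simpa only [hF, Option.elim, linForm_single_obs] using (h2 (some j)).le
    · simpa only [hF, Option.elim, linForm_noiseCoef_obs] using (h2 none).le
  refine (measureReal_mono hsub).trans ((measureReal_union_le _ _).trans ?_)
  have hA' : μ.real (⋃ o, A o) ≤ ((p : ℝ) + 1) ^ 2 * (4 * E) := by
    refine (measureReal_iUnion_fintype_le _).trans ((Finset.sum_le_sum fun o _ => hAle o).trans ?_)
    simp [sq]
  have hB' : μ.real (⋃ o, B o) ≤ ((p : ℝ) + 1) * (2 * E) := by
    refine (measureReal_iUnion_fintype_le _).trans ((Finset.sum_le_sum fun o _ => hBle o).trans ?_)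
    simp
  have hp : (1 : ℝ) ≤ (p : ℝ) + 1 := by linarith [(Nat.cast_nonneg p : (0 : ℝ) ≤ p)]
  nlinarith [mul_le_mul_of_nonneg_left hp (by positivity : 0 ≤ ((p : ℝ) + 1) * E)]

end Observations

/-! ### Population quantities -/

/-- In an orthonormal eigenbasis the form is an eigenvalue-weighted sum of squared coordinates, to
be compared with Parseval's identity. -/
theorem linCov_bounds_of_eigenvalues {ι : Type*} [Fintype ι] [DecidableEq ι] {S : Matrix ι ι ℝ}
    (hS : S.IsHermitian) {c₁ c₂ : ℝ} (h : ∀ i, c₁ ≤ hS.eigenvalues i ∧ hS.eigenvalues i ≤ c₂)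
    (u : ι → ℝ) : c₁ * (u ⬝ᵥ u) ≤ linCov S u u ∧ linCov S u u ≤ c₂ * (u ⬝ᵥ u) := by
  set b := hS.eigenvectorBasis with hb
  set U : EuclideanSpace ℝ ι := WithLp.toLp 2 u with hU
  have hdot : ∀ a c : ι → ℝ, a ⬝ᵥ c = inner ℝ (WithLp.toLp 2 a) (WithLp.toLp 2 c) := by
    intro a c
    simp [PiLp.inner_apply, dotProduct, mul_comm]
  have h1 : u ⬝ᵥ u = ∑ i, inner ℝ U (b i) ^ 2 := by
    rw [hdot, ← b.sum_inner_mul_inner U U]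
    exact Finset.sum_congr rfl fun i _ => by rw [real_inner_comm U (b i), sq]
  have h2 : linCov S u u = ∑ i, hS.eigenvalues i * inner ℝ U (b i) ^ 2 := by
    rw [linCov, hdot, ← b.sum_inner_mul_inner]
    refine Finset.sum_congr rfl fun i _ => ?_
    have h3 : inner ℝ (b i) (WithLp.toLp 2 (S.mulVec u)) =
        hS.eigenvalues i * inner ℝ U (b i) := by
      have h4 : inner ℝ (b i) (WithLp.toLp 2 (S.mulVec u)) = (b i).ofLp ⬝ᵥ S.mulVec u := by
        rw [hdot]
      have h5 : S.IsSymm := by simpa [Matrix.IsHermitian, Matrix.IsSymm] using hS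
      rw [h4, Matrix.dotProduct_mulVec, ← Matrix.mulVec_transpose, h5.eq,
        hS.mulVec_eigenvectorBasis, smul_dotProduct, hdot, smul_eq_mul,
        real_inner_comm]
    rw [h3]
    ring
  rw [h1, h2, Finset.mul_sum, Finset.mul_sum]
  exact ⟨Finset.sum_le_sum fun i _ => mul_le_mul_of_nonneg_right (h i).1 (sq_nonneg _),
    Finset.sum_le_sum fun i _ => mul_le_mul_of_nonneg_right (h i).2 (sq_nonneg _)⟩

/-! ### Orthogonality of prediction errors -/

section PredError

variable {ι : Type*} [Fintype ι] [DecidableEq ι] {S : Matrix ι ι ℝ}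

/-- Prediction errors are uncorrelated with the predictors. -/
theorem mulVec_predError (hS : S.PosDef) {T : Finset ι} (a : ι) {t : ι} (ht : t ∈ T) :
    S.mulVec (predError S T a) t = 0 := by
  set A := S.submatrix (fun k : T => (k : ι)) (fun k : T => (k : ι)) with hA
  have hApd : A.PosDef := hS.submatrix Subtype.val_injective
  have hAA : A * A⁻¹ = 1 := Matrix.mul_nonsing_inv _ ((Matrix.isUnit_iff_isUnit_det _).1 hApd.isUnit)
  set w := A⁻¹.mulVec (fun k : T => S k a) with hw
  have h1 : A.mulVec w ⟨t, ht⟩ = S t a := by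
    rw [hw, Matrix.mulVec_mulVec, hAA, Matrix.one_mulVec]
  have h2 : ∑ i, S t i * (if h : i ∈ T then w ⟨i, h⟩ else 0) = A.mulVec w ⟨t, ht⟩ := by
    rw [Matrix.mulVec, dotProduct, ← Finset.sum_subset (Finset.subset_univ T)]
    · rw [← Finset.sum_coe_sort T]
      refine Finset.sum_congr rfl fun i _ => ?_
      rw [dif_pos i.2]
      rfl
    · intro i _ hi
      rw [dif_neg hi, mul_zero]
  simp only [Matrix.mulVec, dotProduct, predError, mul_sub, Finset.sum_sub_distrib]
  rw [sub_eq_zero]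
  simp only [mul_ite, mul_one, mul_zero, Finset.sum_ite_eq', Finset.mem_univ, if_true]
  exact h1.symm.trans h2.symm

theorem predError_self {T : Finset ι} {a : ι} (ha : a ∉ T) : predError S T a a = 1 := by
  simp [predError, ha]

theorem predError_of_notMem {T : Finset ι} {a i : ι} (hi : i ∉ T) (hia : i ≠ a) :
    predError S T a i = 0 := by
  simp [predError, hi, hia]

/-- The first error lives on `T ∪ {a}` with coefficient 1 at `a`, and the second is uncorrelated
with everything in `T`, so only the coordinate `a` contributes. -/
theorem linCov_predError (hS : S.PosDef) {T : Finset ι} {a : ι} (b : ι) (ha : a ∉ T) :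
    linCov S (predError S T a) (predError S T b) = S.mulVec (predError S T b) a := by
  rw [linCov, dotProduct, Finset.sum_eq_single a]
  · rw [predError_self ha, one_mul]
  · intro i _ hia
    by_cases hi : i ∈ T
    · rw [mulVec_predError hS b hi, mul_zero]
    · rw [predError_of_notMem hi hia, zero_mul]
  · simp

end PredError

/-! ### SPACs, precision entries and variance bounds -/

section Population

variable {p : ℕ} {S : Matrix (Option (Fin p)) (Option (Fin p)) ℝ} {β : Fin p → ℝ}

theorem posDef_covX (hS : S.PosDef) : (covX S).PosDef := hS.submatrix (Option.some_injective _)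

theorem precDiag_pos (hS : S.PosDef) (j : Fin p) : 0 < precDiag S j :=
  (posDef_covX hS).inv.diag_pos

/-- The error vector `e` of `X_j` does not involve `Y`, and `C e = τ e_j` by orthogonality to the
other covariates. Hence `e = τ C⁻¹ e_j`, and its `j`-th coordinate reads `1 = τ d_jj`. -/
theorem mulVec_predError_some (hS : S.PosDef) (j : Fin p) :
    S.mulVec (predError S (others j) (some j)) (some j) = (precDiag S j)⁻¹ := by
  have hC := posDef_covX hS
  have hCC : (covX S)⁻¹ * covX S = 1 :=
    Matrix.nonsing_inv_mul _ ((Matrix.isUnit_iff_isUnit_det _).1 hC.isUnit)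
  set e := predError S (others j) (some j) with he
  set τ := S.mulVec e (some j) with hτ
  have hnone : e none = 0 := predError_of_notMem (by simp [others]) (by simp)
  have hone : e (some j) = 1 := predError_self (by simp [others])
  have h1 : (covX S).mulVec (fun k => e (some k)) = τ • Pi.single j 1 := by
    ext k
    have h2 : (covX S).mulVec (fun k => e (some k)) k = S.mulVec e (some k) := by
      simp [Matrix.mulVec, dotProduct, Fintype.sum_option, hnone, covX]
    rw [h2]
    by_cases hk : k = j
    · subst hk; simp [hτ]
    · rw [he, mulVec_predError hS _ (by simp [others, hk])]
      simp [hk]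
  have h3 : (fun k => e (some k)) = (covX S)⁻¹.mulVec (τ • Pi.single j 1) := by
    rw [← h1, Matrix.mulVec_mulVec, hCC, Matrix.one_mulVec]
  have h4 : 1 = τ * precDiag S j := by
    rw [← hone, show e (some j) = (fun k => e (some k)) j from rfl, h3]
    simp [Matrix.mulVec_smul, precDiag]
  exact eq_inv_of_mul_eq_one_left h4.symm

/-- The SPAC is the regression coefficient divided by `√d_jj`. -/
theorem spac_eq (hS : S.PosDef)
    (hβ : ∀ k, linCov S (noiseCoef β) (Pi.single (some k) 1) = 0) (j : Fin p) :
    spac S j = β j / Real.sqrt (precDiag S j) := by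
  have hnT : none ∉ others j := by simp [others]
  have hjT : some j ∉ others j := by simp [others]
  have hd := precDiag_pos hS j
  have hτ : partialCov S j (some j) (some j) = (precDiag S j)⁻¹ := by
    rw [partialCov, linCov_predError hS _ hjT, mulVec_predError_some hS]
  have hcross : partialCov S j none (some j) = (precDiag S j)⁻¹ * β j := by
    set e := predError S (others j) (some j) with he
    -- The noise is uncorrelated with `e`, a combination of covariates. Expanding the noise as `Y -
    -- ∑ β_k X_k`, all terms with `k ≠ j` vanish, so `Cov(Y, e) = β_j Var(e)`.
    have h0 : linCov S (noiseCoef β) e = 0 := by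
      rw [linCov, Matrix.dotProduct_mulVec, dotProduct, Fintype.sum_option,
        he, predError_of_notMem hnT (by simp), mul_zero, zero_add]
      refine Finset.sum_eq_zero fun k _ => ?_
      have := hβ k
      rw [linCov, Matrix.dotProduct_mulVec, dotProduct_single, mul_one] at this
      rw [this, zero_mul]
    rw [partialCov, linCov_predError hS _ hnT]
    rw [linCov, dotProduct, Fintype.sum_option, Finset.sum_eq_single j] at h0
    · rw [he, mulVec_predError_some hS] at h0
      simp only [noiseCoef, Option.elim] at h0
      linarith
    · intro k _ hk
      rw [he, mulVec_predError hS _ (by simp [others, hk]), mul_zero]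
    · simp
  have hYY : 0 < partialCov S j none none := by
    have hne : predError S (others j) none ≠ 0 := fun h => by
      have := predError_self (S := S) hnT
      rw [h] at this
      simp at this
    simpa [partialCov, linCov] using hS.dotProduct_mulVec_pos hne
  -- The factor `s_j` cancels against the denominator of `ρ_j`, leaving `β_j / d_jj` divided by `√(1
  -- / d_jj)`.
  rw [spac, partialCorr, condSd, hτ, hcross, Real.sqrt_mul hYY.le, Real.sqrt_inv]
  have h1 : Real.sqrt (partialCov S j none none) ≠ 0 := (Real.sqrt_pos.2 hYY).ne'
  have h2 : Real.sqrt (precDiag S j) ≠ 0 := (Real.sqrt_pos.2 hd).ne'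
  have h3 := Real.mul_self_sqrt hd.le
  nth_rewrite 1 [← h3]
  field_simp

/-- Covariance matrices whose quadratic form is bounded between multiples of the identity. -/
structure FormBounds {ι : Type*} [Fintype ι] (S : Matrix ι ι ℝ) (c₁ c₂ : ℝ) : Prop where
  symm : S.IsSymm
  lower : ∀ u, c₁ * (u ⬝ᵥ u) ≤ linCov S u u
  upper : ∀ u, linCov S u u ≤ c₂ * (u ⬝ᵥ u)

theorem FormBounds.posDef {ι : Type*} [Fintype ι] {S : Matrix ι ι ℝ} {c₁ c₂ : ℝ}
    (h : FormBounds S c₁ c₂) (hc : 0 < c₁) : S.PosDef := by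
  refine Matrix.PosDef.of_dotProduct_mulVec_pos ?_ fun u hu => ?_
  · simpa [Matrix.IsHermitian, Matrix.IsSymm] using h.symm
  · have h1 : 0 < u ⬝ᵥ u := 
      lt_of_le_of_ne (Finset.sum_nonneg fun i _ => mul_self_nonneg _)
        fun h0 => hu (dotProduct_self_eq_zero.1 h0.symm)
    have := h.lower u
    simp only [star_trivial]
    exact (mul_pos hc h1).trans_le this

/-- Extension of vectors by zero preserves both quadratic forms. This plays the role of eigenvalue
interlacing for principal submatrices. -/
theorem FormBounds.submatrix {ι κ : Type*} [Fintype ι] [Fintype κ] {S : Matrix ι ι ℝ}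
    {c₁ c₂ : ℝ} (h : FormBounds S c₁ c₂) {f : κ → ι} (hf : Function.Injective f) :
    FormBounds (S.submatrix f f) c₁ c₂ := by
  classical
  set g : (κ → ℝ) → ι → ℝ := fun u => Function.extend f u 0 with hg
  have hgf : ∀ u k, g u (f k) = u k := fun u k => hf.extend_apply _ _ _
  have hsum : ∀ (F : ι → ℝ), (∀ i, (∀ k, f k ≠ i) → F i = 0) → ∑ i, F i = ∑ k, F (f k) := by
    intro F hF
    rw [← Finset.sum_image (f := F) (g := f) (s := Finset.univ) (fun a _ b _ hab => hf hab)]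
    refine (Finset.sum_subset (Finset.subset_univ _) fun i _ hi => hF i fun k hk => hi ?_).symm
    exact Finset.mem_image.2 ⟨k, Finset.mem_univ _, hk⟩
  have hg0 : ∀ u i, (∀ k, f k ≠ i) → g u i = 0 := fun u i hi => by
    simp [hg, Function.extend_apply' _ _ _ (fun ⟨k, hk⟩ => hi k hk)]
  have h1 : ∀ u, g u ⬝ᵥ g u = u ⬝ᵥ u := fun u => by
    rw [dotProduct, hsum _ fun i hi => by rw [hg0 u i hi, zero_mul]]
    simp only [hgf]
    rfl
  have h2 : ∀ u, linCov S (g u) (g u) = linCov (S.submatrix f f) u u := fun u => by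
    rw [linCov, dotProduct, hsum _ fun i hi => by rw [hg0 u i hi, zero_mul]]
    refine Finset.sum_congr rfl fun k _ => ?_
    rw [hgf, Matrix.mulVec, dotProduct, hsum _ fun i hi => by rw [hg0 u i hi, mul_zero]]
    simp only [hgf]
    rfl
  exact ⟨h.symm.submatrix f, fun u => by rw [← h1, ← h2]; exact h.lower _,
    fun u => by rw [← h1, ← h2]; exact h.upper _⟩

/-- With `f = C⁻¹ e_j` and `d = d_jj`, nonnegativity of the form at `d e_j - f` says `d² - d ≥ 0`.
-/
theorem one_le_precDiag (hS : S.PosDef) {j : Fin p} (hj : covX S j j = 1) : 1 ≤ precDiag S j := by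
  have hC := posDef_covX hS
  have hd := precDiag_pos hS j
  have hCC : covX S * (covX S)⁻¹ = 1 :=
    Matrix.mul_nonsing_inv _ ((Matrix.isUnit_iff_isUnit_det _).1 hC.isUnit)
  set f := (covX S)⁻¹.mulVec (Pi.single j 1) with hf
  have hCf : (covX S).mulVec f = Pi.single j 1 := by
    rw [hf, Matrix.mulVec_mulVec, hCC, Matrix.one_mulVec]
  have hfj : f j = precDiag S j := by simp [hf, precDiag]
  have hs : (covX S).IsSymm := isSymm_of_posSemidef hC.posSemidef
  have h1 : linCov (covX S) f f = precDiag S j := by rw [linCov, hCf]; simp [hfj]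
  have h2 : linCov (covX S) (Pi.single j 1) f = 1 := by rw [linCov, hCf]; simp
  have h3 : linCov (covX S) (Pi.single j 1) (Pi.single j 1) = 1 := by simp [linCov, hj]
  have h4 := linCov_self_nonneg hC.posSemidef (precDiag S j • Pi.single j 1 - f)
  have hsm : ∀ u, linCov (covX S) (precDiag S j • Pi.single j 1) u =
      precDiag S j * linCov (covX S) (Pi.single j 1) u := fun u => by
    simp only [linCov, smul_dotProduct, smul_eq_mul]
  rw [linCov_sub_left, linCov_sub_right, linCov_sub_right, linCov_comm hs f, hsm, hsm,
    linCov_comm hs _ (precDiag S j • Pi.single j 1), hsm, h1, h2, h3] at h4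
  nlinarith

/-- For `f = C⁻¹ e_j` one has `c₁ d_jj² ≤ c₁ ‖f‖² ≤ fᵀ C f = d_jj`. -/
theorem precDiag_le {c₁ c₂ : ℝ} (h : FormBounds S c₁ c₂) (hc : 0 < c₁) (j : Fin p) :
    precDiag S j ≤ 1 / c₁ := by
  have hS := h.posDef hc
  have hC := posDef_covX hS
  have hd := precDiag_pos hS j
  have hCC : covX S * (covX S)⁻¹ = 1 :=
    Matrix.mul_nonsing_inv _ ((Matrix.isUnit_iff_isUnit_det _).1 hC.isUnit)
  set f := (covX S)⁻¹.mulVec (Pi.single j 1) with hf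
  have hCf : (covX S).mulVec f = Pi.single j 1 := by
    rw [hf, Matrix.mulVec_mulVec, hCC, Matrix.one_mulVec]
  have hfj : f j = precDiag S j := by simp [hf, precDiag]
  have h1 : linCov (covX S) f f = precDiag S j := by rw [linCov, hCf]; simp [hfj]
  have h2 : c₁ * (f ⬝ᵥ f) ≤ linCov (covX S) f f :=
    (h.submatrix (Option.some_injective _)).lower f
  have h3 : f j * f j ≤ f ⬝ᵥ f :=
    Finset.single_le_sum (f := fun i => f i * f i) (fun i _ => mul_self_nonneg _)
      (Finset.mem_univ j)
  rw [hfj] at h3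
  rw [le_div_iff₀ hc]
  have h4 := mul_le_mul_of_nonneg_left h3 hc.le
  nlinarith

/-- The explained variance and the noise variance are both at most the variance of the response. -/
theorem linCov_noiseCoef_self {c₁ c₂ : ℝ} (h : FormBounds S c₁ c₂) (hc : 0 < c₁)
    (hβ : ∀ k, linCov S (noiseCoef β) (Pi.single (some k) 1) = 0) :
    c₁ * (β ⬝ᵥ β) ≤ c₂ ∧ linCov S (noiseCoef β) (noiseCoef β) ≤ c₂ := by
  have hS := h.posDef hc
  set b : Option (Fin p) → ℝ := fun o => o.elim 0 β with hb
  have hw : noiseCoef β = Pi.single none 1 - b := by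
    ext (_ | k) <;> simp [noiseCoef, hb]
  have h0 : linCov S (noiseCoef β) b = 0 := by
    rw [linCov, Matrix.dotProduct_mulVec, dotProduct, Fintype.sum_option]
    simp only [hb, Option.elim, mul_zero, zero_add]
    refine Finset.sum_eq_zero fun k _ => ?_
    have := hβ k
    rw [linCov, Matrix.dotProduct_mulVec, dotProduct_single, mul_one] at this
    rw [this, zero_mul]
  -- Pythagoras: `Y` is the sum of the noise and the signal `∑ β_k X_k`, which are uncorrelated.
  have h1 : (Pi.single none 1 : Option (Fin p) → ℝ) = noiseCoef β + b := by rw [hw]; simp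
  have h2 : linCov S (Pi.single none 1) (Pi.single none 1) =
      linCov S (noiseCoef β) (noiseCoef β) + linCov S b b := by
    rw [h1, linCov_add_left, linCov_add_right, linCov_add_right, h0,
      linCov_comm h.symm b, h0]
    ring
  have h3 : linCov S (Pi.single none 1) (Pi.single none 1) ≤ c₂ := by
    simpa using h.upper (Pi.single none 1)
  have h4 : c₁ * (β ⬝ᵥ β) ≤ linCov S b b := by
    have : b ⬝ᵥ b = β ⬝ᵥ β := by simp [hb, dotProduct, Fintype.sum_option]
    rw [← this]
    exact h.lower b
  have h5 := linCov_self_nonneg hS.posSemidef b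
  have h6 := linCov_self_nonneg hS.posSemidef (noiseCoef β)
  exact ⟨by linarith, by linarith⟩

end Population

/-! ### Optimality conditions for the SPAC-Lasso -/

section Optimality

variable {n p : ℕ} {lam : ℝ} {d : Fin p → ℝ} {Z : Matrix (Fin n) (Fin p) ℝ} {y : Fin n → ℝ}
  {g z : Fin p → ℝ}

/-- The excess loss over a point that satisfies the stationarity conditions with subgradient
`z`. -/
theorem lassoLoss_sub (hd : ∀ j, 0 ≤ d j)
    (hkkt : ∀ j, ∑ i, Z i j * (y i - ∑ k, Z i k * Real.sqrt (d k) * g k) =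
      lam * (Real.sqrt (d j) * z j))
    (hzg : ∀ j, z j * g j = |g j|) (g' : Fin p → ℝ) :
    lassoLoss lam d Z y g' - lassoLoss lam d Z y g =
      1 / 2 * ∑ i, (∑ j, Z i j * (Real.sqrt (d j) * (g' j - g j))) ^ 2 +
        lam * ∑ j, d j * (|g' j| - z j * g' j) := by
  set r : Fin n → ℝ := fun i => y i - ∑ k, Z i k * Real.sqrt (d k) * g k with hr
  set u : Fin n → ℝ := fun i => ∑ j, Z i j * (Real.sqrt (d j) * (g' j - g j)) with hu
  have h1 : ∀ i, y i - ∑ k, Z i k * Real.sqrt (d k) * g' k = r i - u i := by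
    intro i
    rw [hr, hu]
    simp only [sub_sub, ← Finset.sum_add_distrib]
    congr 2
    ext k
    ring
  have h2 : ∑ i, r i * u i = lam * ∑ j, d j * (z j * g' j - |g j|) := by
    calc ∑ i, r i * u i
        = ∑ j, (∑ i, Z i j * r i) * (Real.sqrt (d j) * (g' j - g j)) := by
          simp only [hu, Finset.mul_sum, Finset.sum_mul]
          rw [Finset.sum_comm]
          exact Finset.sum_congr rfl fun _ _ => Finset.sum_congr rfl fun _ _ => by ring
      _ = _ := by
          rw [Finset.mul_sum]
          refine Finset.sum_congr rfl fun j _ => ?_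
          rw [hkkt j, ← hzg j]
          nth_rewrite 3 [← Real.mul_self_sqrt (hd j)]
          ring
  have h3 : ∑ i, (r i - u i) ^ 2 = ∑ i, r i ^ 2 - 2 * ∑ i, r i * u i + ∑ i, u i ^ 2 := by
    rw [Finset.mul_sum, ← Finset.sum_sub_distrib, ← Finset.sum_add_distrib]
    exact Finset.sum_congr rfl fun _ _ => by ring
  have h4 : ∑ j, d j * (|g' j| - z j * g' j) =
      ∑ j, d j * |g' j| - ∑ j, d j * |g j| - ∑ j, d j * (z j * g' j - |g j|) := by
    rw [← Finset.sum_sub_distrib, ← Finset.sum_sub_distrib]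
    exact Finset.sum_congr rfl fun _ _ => by ring
  simp only [lassoLoss, h1, h3, h2, h4]
  ring

/-- A point that satisfies the stationarity conditions, with strict dual feasibility outside of a
set of coordinates on which the design is injective, is the unique minimizer. -/
theorem isLassoSolution_iff_eq (hlam : 0 < lam) (hd : ∀ j, 0 < d j)
    (hkkt : ∀ j, ∑ i, Z i j * (y i - ∑ k, Z i k * Real.sqrt (d k) * g k) =
      lam * (Real.sqrt (d j) * z j))
    (hzg : ∀ j, z j * g j = |g j|) (hz : ∀ j, |z j| ≤ 1) {P : Fin p → Prop}
    (hzP : ∀ j, ¬ P j → |z j| < 1)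
    (hinj : ∀ x : Fin p → ℝ, (∀ j, ¬ P j → x j = 0) → (∀ i, ∑ j, Z i j * x j = 0) →
      ∀ j, x j = 0) (g' : Fin p → ℝ) :
    IsLassoSolution lam d Z y g' ↔ g' = g := by
  have hsub := lassoLoss_sub (fun j => (hd j).le) hkkt hzg
  have hterm : ∀ (u : Fin p → ℝ) j, 0 ≤ d j * (|u j| - z j * u j) := fun u j => by
    refine mul_nonneg (hd j).le (sub_nonneg.2 ((le_abs_self _).trans ?_))
    rw [abs_mul]
    exact mul_le_of_le_one_left (abs_nonneg _) (hz j)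
  have hsq : ∀ u : Fin p → ℝ,
      0 ≤ ∑ i, (∑ j, Z i j * (Real.sqrt (d j) * (u j - g j))) ^ 2 := fun u =>
    Finset.sum_nonneg fun _ _ => sq_nonneg _
  have hpen : ∀ u : Fin p → ℝ, 0 ≤ ∑ j, d j * (|u j| - z j * u j) := fun u =>
    Finset.sum_nonneg fun j _ => hterm u j
  constructor
  · intro h
    -- For a second minimizer both nonnegative parts of the excess loss vanish: the penalty part
    -- forces zeros where `|z j| < 1`, and then the quadratic part forces equality by injectivity on
    -- `P`.
    have h0 := h g
    have h1 := hsub g'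
    have h2 : lam * ∑ j, d j * (|g' j| - z j * g' j) = 0 :=
      le_antisymm (by linarith [hsq g']) (mul_nonneg hlam.le (hpen g'))
    have h3 : ∑ i, (∑ j, Z i j * (Real.sqrt (d j) * (g' j - g j))) ^ 2 = 0 :=
      le_antisymm (by linarith) (hsq g')
    have h4 := (mul_eq_zero.1 h2).resolve_left hlam.ne'
    rw [Finset.sum_eq_zero_iff_of_nonneg fun j _ => hterm g' j] at h4
    rw [Finset.sum_eq_zero_iff_of_nonneg fun _ _ => sq_nonneg _] at h3
    have hzero : ∀ (u : Fin p → ℝ) j, ¬ P j → |u j| = z j * u j → u j = 0 := by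
      intro u j hj hu
      by_contra hne
      have h5 : |u j| ≤ |z j| * |u j| := by
        rw [← abs_mul, ← hu, abs_abs]
      nlinarith [abs_pos.2 hne, hzP j hj]
    have hx := hinj (fun j => Real.sqrt (d j) * (g' j - g j)) (fun j hj => ?_)
      fun i => by simpa using h3 i (Finset.mem_univ i)
    · ext j
      have := (mul_eq_zero.1 (hx j)).resolve_left (Real.sqrt_pos.2 (hd j)).ne'
      linarith
    · have h5 := (mul_eq_zero.1 (h4 j (Finset.mem_univ j))).resolve_left (hd j).ne'
      simp [hzero g' j hj (by linarith), hzero g j hj (hzg j).symm]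
  · rintro rfl u
    have h1 := hsub u
    have h2 := mul_nonneg hlam.le (hpen u)
    linarith [hsq u]

end Optimality

/-! ### Euclidean norms -/

section VNorm

variable {ι κ : Type*} [Fintype ι] [Fintype κ]

/-- The Euclidean norm of a vector with an arbitrary finite index type. -/
noncomputable def vnorm (u : ι → ℝ) : ℝ := ‖(WithLp.toLp 2 u : EuclideanSpace ℝ ι)‖

theorem vnorm_nonneg (u : ι → ℝ) : 0 ≤ vnorm u := norm_nonneg _

theorem vnorm_sq (u : ι → ℝ) : vnorm u ^ 2 = u ⬝ᵥ u := by
  rw [vnorm, EuclideanSpace.real_norm_sq_eq]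
  simp [dotProduct, sq]

theorem vnorm_add_le (u v : ι → ℝ) : vnorm (u + v) ≤ vnorm u + vnorm v := by
  simpa [vnorm] using norm_add_le (WithLp.toLp 2 u : EuclideanSpace ℝ ι) (WithLp.toLp 2 v)

theorem abs_dotProduct_le (u v : ι → ℝ) : |u ⬝ᵥ v| ≤ vnorm u * vnorm v := by
  simpa [vnorm, PiLp.inner_apply, dotProduct, mul_comm] using
    abs_real_inner_le_norm (WithLp.toLp 2 u : EuclideanSpace ℝ ι) (WithLp.toLp 2 v)

theorem vnorm_le_of_dotProduct_le {u : ι → ℝ} {a : ℝ} (ha : 0 ≤ a) (h : u ⬝ᵥ u ≤ a ^ 2) :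
    vnorm u ≤ a := by
  rw [← vnorm_sq] at h
  exact (pow_le_pow_iff_left₀ (vnorm_nonneg u) ha two_ne_zero).1 h

theorem abs_apply_le_vnorm (u : ι → ℝ) (i : ι) : |u i| ≤ vnorm u := by
  simpa [vnorm] using PiLp.norm_apply_le (WithLp.toLp 2 u : EuclideanSpace ℝ ι) i

theorem vnorm_le_mul_of_abs_le {u v : ι → ℝ} {c : ℝ} (hc : 0 ≤ c) (h : ∀ i, |u i| ≤ c * |v i|) :
    vnorm u ≤ c * vnorm v := by
  refine vnorm_le_of_dotProduct_le (mul_nonneg hc (vnorm_nonneg v)) ?_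
  rw [mul_pow, vnorm_sq, dotProduct, dotProduct, Finset.mul_sum]
  refine Finset.sum_le_sum fun i _ => ?_
  have h1 := mul_self_le_mul_self (abs_nonneg (u i)) (h i)
  rw [abs_mul_abs_self] at h1
  calc u i * u i ≤ c * |v i| * (c * |v i|) := h1
    _ = c ^ 2 * (|v i| * |v i|) := by ring
    _ = c ^ 2 * (v i * v i) := by rw [abs_mul_abs_self]

theorem vnorm_le_sqrt_card_mul {u : ι → ℝ} {a : ℝ} (ha : 0 ≤ a) (h : ∀ i, |u i| ≤ a) :
    vnorm u ≤ Real.sqrt (Fintype.card ι) * a := by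
  refine vnorm_le_of_dotProduct_le (by positivity) ?_
  rw [mul_pow, Real.sq_sqrt (Nat.cast_nonneg _), dotProduct]
  refine (Finset.sum_le_sum (g := fun _ => a ^ 2) fun i _ => ?_).trans (by simp)
  rw [← abs_mul_abs_self, sq]
  exact mul_self_le_mul_self (abs_nonneg _) (h i)

/-- Cauchy–Schwarz row by row. For a square matrix of size `q` the operator norm is thus at most `q
a`; a further `√q` from the norm of the correction leads to the requirement `q = o((n / log
n)^(1/3))`. -/
theorem vnorm_mulVec_le {E : Matrix κ ι ℝ} {a : ℝ} (ha : 0 ≤ a) (h : ∀ i j, |E i j| ≤ a)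
    (u : ι → ℝ) :
    vnorm (E.mulVec u) ≤
      Real.sqrt (Fintype.card κ) * (Real.sqrt (Fintype.card ι) * a * vnorm u) :=
  vnorm_le_sqrt_card_mul (mul_nonneg (by positivity) (vnorm_nonneg u)) fun i =>
    (abs_dotProduct_le (E i) u).trans (mul_le_mul_of_nonneg_right
      (vnorm_le_sqrt_card_mul ha (h i)) (vnorm_nonneg u))

end VNorm

/-! ### The restricted stationarity equation -/

section Restricted

variable {α κ : Type*} [Fintype α] {C G : Matrix α α ℝ} {c₁ a : ℝ}

/-- The perturbation `G - C` has operator norm at most `card α * a ≤ c₁ / 2`, so half of the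
coercivity survives. -/
theorem form_lower_of_close (hC : ∀ u, c₁ * (u ⬝ᵥ u) ≤ linCov C u u) (ha : 0 ≤ a)
    (hG : ∀ i j, |G i j - C i j| ≤ a) (hm : Fintype.card α * a ≤ c₁ / 2) (u : α → ℝ) :
    c₁ / 2 * (u ⬝ᵥ u) ≤ u ⬝ᵥ G.mulVec u := by
  have h1 : u ⬝ᵥ G.mulVec u = linCov C u u + u ⬝ᵥ (G - C).mulVec u := by
    rw [linCov, Matrix.sub_mulVec, dotProduct_sub]; ring
  have h2 := abs_dotProduct_le u ((G - C).mulVec u)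
  have h3 := vnorm_mulVec_le ha hG u
  have h4 : vnorm u * vnorm ((G - C).mulVec u) ≤ c₁ / 2 * (u ⬝ᵥ u) := by
    refine (mul_le_mul_of_nonneg_left h3 (vnorm_nonneg u)).trans ?_
    rw [← mul_assoc (Real.sqrt _), ← mul_assoc (Real.sqrt _),
      Real.mul_self_sqrt (Nat.cast_nonneg _), ← vnorm_sq]
    nlinarith [mul_le_mul_of_nonneg_right hm (sq_nonneg (vnorm u))]
  have h5 := neg_abs_le (u ⬝ᵥ (G - C).mulVec u)
  have h6 := hC u
  linarith

theorem eq_zero_of_mulVec_eq_zero (hC : ∀ u, c₁ * (u ⬝ᵥ u) ≤ linCov C u u) (hc : 0 < c₁)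
    (ha : 0 ≤ a) (hG : ∀ i j, |G i j - C i j| ≤ a) (hm : Fintype.card α * a ≤ c₁ / 2)
    {u : α → ℝ} (hu : G.mulVec u = 0) : u = 0 := by
  have h := form_lower_of_close hC ha hG hm u
  rw [hu, dotProduct_zero] at h
  have h1 : 0 ≤ u ⬝ᵥ u := Finset.sum_nonneg fun i _ => mul_self_nonneg _
  refine dotProduct_self_eq_zero.1 (le_antisymm ?_ h1)
  nlinarith

variable [DecidableEq α]

/-- If the Gram matrix `G` and the cross moments `g` are close to their population values `C`
and `c`, then the restricted stationarity equation has a small solution, which is strictly dual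
feasible under the irrepresentable condition on `θ = C⁻¹ c`. -/
theorem exists_restricted_solution {g c θ : κ → α → ℝ} {h₁ s w w₀ : α → ℝ} {h₂ v v₀ : κ → ℝ}
    {τ B η ε : ℝ} (hC : ∀ u, c₁ * (u ⬝ᵥ u) ≤ linCov C u u) (hCs : C.IsSymm) (hc : 0 < c₁)
    (ha : 0 ≤ a) (hτ : 0 < τ) (hB : 0 ≤ B) (hcard : 1 ≤ Fintype.card α)
    (hG : ∀ i j, |G i j - C i j| ≤ a) (hg : ∀ i j, |g i j - c i j| ≤ a)
    (hh₁ : ∀ i, |h₁ i| ≤ a) (hh₂ : ∀ i, |h₂ i| ≤ a) (hs : ∀ i, |s i| ≤ 1)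
    (hw : ∀ i, |w i - w₀ i| ≤ a) (hw₀ : ∀ i, |w₀ i| ≤ B) (hv : ∀ i, v₀ i - a ≤ v i)
    (hv₀ : ∀ i, 1 ≤ v₀ i) (hθ : ∀ i, C.mulVec (θ i) = c i) (hθB : ∀ i, vnorm (θ i) ≤ B)
    (hirr : ∀ i, |θ i ⬝ᵥ (w₀ * s)| ≤ (1 - η) * v₀ i) (hη : 0 < η)
    (hε1 : ε ≤ 1) (hεc : ε ≤ c₁ / 2)
    (hε : ε * (2 + 2 * (B + 2) / c₁ + B * (2 * (B + 2) / c₁) + 2 * B) < η)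
    (hsmall : Fintype.card α * Real.sqrt (Fintype.card α) * a ≤ ε)
    (hsmall' : Real.sqrt (Fintype.card α) * a ≤ ε * τ) :
    ∃ D : α → ℝ, G.mulVec D = h₁ - τ • (w * s) ∧
      vnorm D ≤ 2 * (B + 2) / c₁ * (Real.sqrt (Fintype.card α) * τ) ∧
      ∀ i, |h₂ i - g i ⬝ᵥ D| < τ * v i := by
  set m : ℝ := (Fintype.card α : ℝ) with hm
  set r := Real.sqrt m with hr
  set K := 2 * (B + 2) / c₁ with hK
  have hm1 : (1 : ℝ) ≤ m := Nat.one_le_cast.2 hcard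
  have hr1 : 1 ≤ r := Real.one_le_sqrt.2 hm1
  have hrr : r * r = m := Real.mul_self_sqrt (by linarith)
  have hK0 : 0 < K := by positivity
  have hma : m * a ≤ ε := by nlinarith [mul_nonneg (by linarith : 0 ≤ m) ha]
  have hra : r * a ≤ ε := by
    have := mul_le_mul_of_nonneg_right hm1 (mul_nonneg (by linarith : 0 ≤ r) ha)
    linarith
  have haε : a ≤ ε := by nlinarith
  have haτ : a ≤ ε * τ := by nlinarith
  have hε0 : 0 ≤ ε := ha.trans haε
  have hmc : (Fintype.card α : ℝ) * a ≤ c₁ / 2 := hma.trans hεc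
  have hlow := form_lower_of_close hC ha hG hmc
  have hinj : Function.Injective G.mulVec := by
    refine fun x x' hxx => sub_eq_zero.1 (eq_zero_of_mulVec_eq_zero hC hc ha hG hmc ?_)
    rw [Matrix.mulVec_sub, sub_eq_zero]
    exact hxx
  obtain ⟨D, hD⟩ := (Matrix.mulVec_surjective_iff_isUnit.2
    (Matrix.mulVec_injective_iff_isUnit.1 hinj)) (h₁ - τ • (w * s))
  have hwa : ∀ i, |w i| ≤ B + 1 := fun i => by
    have := abs_add_le (w i - w₀ i) (w₀ i)
    rw [sub_add_cancel] at this
    linarith [hw i, hw₀ i]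
  -- Each entry is at most `(B + 1) τ` from the weights plus `a ≤ τ` from the cross moments.
  have hrhs : vnorm (h₁ - τ • (w * s)) ≤ r * ((B + 2) * τ) := by
    refine vnorm_le_sqrt_card_mul (by positivity) fun i => ?_
    have h1 : |τ * (w i * s i)| ≤ τ * (B + 1) := by
      rw [abs_mul, abs_of_pos hτ, abs_mul]
      refine mul_le_mul_of_nonneg_left ?_ hτ.le
      have := mul_le_mul (hwa i) (hs i) (abs_nonneg _) (by linarith)
      linarith
    have h2 := abs_sub (h₁ i) (τ * (w i * s i))
    have h3 : a ≤ τ := by nlinarith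
    simp only [Pi.sub_apply, Pi.smul_apply, Pi.mul_apply, smul_eq_mul]
    linarith [hh₁ i]
  have hDn : vnorm D ≤ K * (r * τ) := by
    have h1 := hlow D
    rw [hD, ← vnorm_sq] at h1
    have h2 := (le_abs_self _).trans (abs_dotProduct_le D (h₁ - τ • (w * s)))
    rcases (vnorm_nonneg D).eq_or_lt with h0 | h0
    · rw [← h0]; positivity
    · have h3 : c₁ / 2 * vnorm D ≤ r * ((B + 2) * τ) := by
        have : vnorm D * (c₁ / 2 * vnorm D) ≤ vnorm D * (r * ((B + 2) * τ)) := by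
          have := mul_le_mul_of_nonneg_left hrhs h0.le
          nlinarith
        exact le_of_mul_le_mul_left this h0
      rw [hK, div_mul_eq_mul_div, le_div_iff₀ hc]
      linarith
  refine ⟨D, hD, hDn, fun i => ?_⟩
  have hrD : r * a * vnorm D ≤ K * ε * τ := by
    calc r * a * vnorm D ≤ r * a * (K * (r * τ)) := by gcongr
      _ = m * a * (K * τ) := by rw [← hrr]; ring
      _ ≤ ε * (K * τ) := by gcongr
      _ = K * ε * τ := by ring
  have hmD : m * a * vnorm D ≤ K * ε * τ := by
    calc m * a * vnorm D ≤ m * a * (K * (r * τ)) := by gcongr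
      _ = m * r * a * (K * τ) := by ring
      _ ≤ ε * (K * τ) := by gcongr
      _ = K * ε * τ := by ring
  -- Writing `c = C θ` and replacing `C D` by `G D - (G - C) D`, with `G D` known, isolates the
  -- irrepresentable term `τ θᵀ(w₀ s)`. Every other term is a constant times `ε τ`.
  have hdecomp : h₂ i - g i ⬝ᵥ D = h₂ i - (g i - c i) ⬝ᵥ D + θ i ⬝ᵥ (G - C).mulVec D -
      θ i ⬝ᵥ h₁ + τ * (θ i ⬝ᵥ (w₀ * s)) + τ * (θ i ⬝ᵥ ((w - w₀) * s)) := by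
    have h1 : c i ⬝ᵥ D = θ i ⬝ᵥ C.mulVec D := by
      rw [← hθ i, Matrix.dotProduct_mulVec, ← Matrix.mulVec_transpose, hCs.eq]
    have h2 : (w - w₀) * s = w * s - w₀ * s := sub_mul _ _ _
    rw [Matrix.sub_mulVec, hD, h2, sub_dotProduct, h1]
    simp only [dotProduct_sub, dotProduct_smul, smul_eq_mul]
    ring
  have e1 : |(g i - c i) ⬝ᵥ D| ≤ K * ε * τ :=
    (abs_dotProduct_le _ _).trans ((mul_le_mul_of_nonneg_right
      (vnorm_le_sqrt_card_mul ha (hg i)) (vnorm_nonneg D)).trans hrD)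
  have e2 : |θ i ⬝ᵥ (G - C).mulVec D| ≤ B * (K * ε * τ) := by
    refine (abs_dotProduct_le _ _).trans (mul_le_mul (hθB i) ?_ (vnorm_nonneg _) hB)
    refine (vnorm_mulVec_le ha hG D).trans (le_trans (le_of_eq ?_) hmD)
    rw [← hm, ← hr, ← hrr]; ring
  have e3 : |θ i ⬝ᵥ h₁| ≤ B * (ε * τ) :=
    (abs_dotProduct_le _ _).trans (mul_le_mul (hθB i)
      ((vnorm_le_sqrt_card_mul ha hh₁).trans hsmall') (vnorm_nonneg _) hB)
  have e4 : |θ i ⬝ᵥ ((w - w₀) * s)| ≤ B * ε := by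
    refine (abs_dotProduct_le _ _).trans (mul_le_mul (hθB i)
      ((vnorm_le_sqrt_card_mul ha fun k => ?_).trans hra) (vnorm_nonneg _) hB)
    rw [Pi.mul_apply, abs_mul]
    have := mul_le_mul (hw k) (hs k) (abs_nonneg _) ha
    simpa using this
  have hkey : |h₂ i - g i ⬝ᵥ D| ≤ τ * (ε * (1 + K + B * K + 2 * B) + (1 - η) * v₀ i) := by
    rw [hdecomp, abs_le]
    have c4 : |τ * (θ i ⬝ᵥ (w₀ * s))| ≤ τ * ((1 - η) * v₀ i) := by
      rw [abs_mul, abs_of_pos hτ]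
      exact mul_le_mul_of_nonneg_left (hirr i) hτ.le
    have c5 : |τ * (θ i ⬝ᵥ ((w - w₀) * s))| ≤ τ * (B * ε) := by
      rw [abs_mul, abs_of_pos hτ]
      exact mul_le_mul_of_nonneg_left e4 hτ.le
    have b0 := abs_le.1 ((hh₂ i).trans haτ)
    have b1 := abs_le.1 e1
    have b2 := abs_le.1 e2
    have b3 := abs_le.1 e3
    have b4 := abs_le.1 c4
    have b5 := abs_le.1 c5
    have hid : τ * (ε * (1 + K + B * K + 2 * B) + (1 - η) * v₀ i) =
        ε * τ + K * ε * τ + B * (K * ε * τ) + B * (ε * τ) + τ * ((1 - η) * v₀ i) +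
          τ * (B * ε) := by ring
    rw [hid]
    constructor <;> linarith
  refine hkey.trans_lt (mul_lt_mul_of_pos_left ?_ hτ)
  -- The error budget is `ε (1 + K + B K + 2B)` plus one more `ε` for `v ≥ v₀ - a`; together they
  -- stay below `η ≤ η v₀`.
  have h1 : η ≤ η * v₀ i := le_mul_of_one_le_right hη.le (hv₀ i)
  nlinarith [hv i]

end Restricted

/-! ### Signs -/

theorem sign_mul_self_eq_abs (x : ℝ) : Real.sign x * x = |x| := by
  rcases lt_trichotomy x 0 with h | h | h
  · rw [Real.sign_of_neg h, abs_of_neg h]; ring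
  · simp [h]
  · rw [Real.sign_of_pos h, abs_of_pos h]; ring

theorem abs_sign_le_one (x : ℝ) : |Real.sign x| ≤ 1 := by
  rcases Real.sign_apply_eq x with h | h | h <;> simp [h]

theorem sign_mul_of_pos (x : ℝ) {c : ℝ} (hc : 0 < c) : Real.sign (x * c) = Real.sign x := by
  rcases lt_trichotomy x 0 with h | h | h
  · rw [Real.sign_of_neg h, Real.sign_of_neg (mul_neg_of_neg_of_pos h hc)]
  · simp [h]
  · rw [Real.sign_of_pos h, Real.sign_of_pos (mul_pos h hc)]

theorem sign_add_of_abs_lt {x δ : ℝ} (h : |δ| < |x|) : Real.sign (x + δ) = Real.sign x := by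
  obtain ⟨h1, h2⟩ := abs_lt.1 h
  rcases lt_trichotomy x 0 with hx | hx | hx
  · rw [abs_of_neg hx] at h1 h2
    rw [Real.sign_of_neg hx, Real.sign_of_neg (by linarith)]
  · simp [hx] at h
    exact absurd h (abs_nonneg δ).not_gt
  · rw [abs_of_pos hx] at h1 h2
    rw [Real.sign_of_pos hx, Real.sign_of_pos (by linarith)]

theorem abs_sqrt_sub_sqrt_le {x y : ℝ} (hx : 0 ≤ x) (hy : 1 ≤ y) :
    |Real.sqrt x - Real.sqrt y| ≤ |x - y| := by
  have h1 : 1 ≤ Real.sqrt y := Real.one_le_sqrt.2 hy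
  have h2 := Real.sqrt_nonneg x
  have h3 : x - y = (Real.sqrt x - Real.sqrt y) * (Real.sqrt x + Real.sqrt y) := by
    nlinarith [Real.mul_self_sqrt hx, Real.mul_self_sqrt (by linarith : 0 ≤ y)]
  rw [h3, abs_mul, abs_of_nonneg (by linarith : 0 ≤ Real.sqrt x + Real.sqrt y)]
  exact le_mul_of_one_le_right (abs_nonneg _) (by linarith)

/-! ### The irrepresentable vector -/

section Irrepresentable

variable {p : ℕ} {S : Matrix (Option (Fin p)) (Option (Fin p)) ℝ} {c₁ c₂ : ℝ}

/-- The covariance matrix `C₁₁` of the active covariates. -/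
noncomputable def activeCov (S : Matrix (Option (Fin p)) (Option (Fin p)) ℝ) (q : ℕ) :
    Matrix {k : Fin p // (k : ℕ) < q} {k : Fin p // (k : ℕ) < q} ℝ :=
  (covX S).submatrix Subtype.val Subtype.val

/-- The coefficients `C₁₁⁻¹ C₁ⱼ` of the regression of `X_j` on the active covariates. -/
noncomputable def activeCoef (S : Matrix (Option (Fin p)) (Option (Fin p)) ℝ) (q : ℕ)
    (j : Fin p) : {k : Fin p // (k : ℕ) < q} → ℝ :=
  (activeCov S q)⁻¹.mulVec fun k => covX S j k

theorem formBounds_covX (h : FormBounds S c₁ c₂) : FormBounds (covX S) c₁ c₂ :=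
  h.submatrix (Option.some_injective _)

theorem formBounds_activeCov (h : FormBounds S c₁ c₂) (q : ℕ) :
    FormBounds (activeCov S q) c₁ c₂ :=
  (formBounds_covX h).submatrix Subtype.val_injective

theorem activeCov_mulVec_activeCoef (h : FormBounds S c₁ c₂) (hc : 0 < c₁) (q : ℕ) (j : Fin p) :
    (activeCov S q).mulVec (activeCoef S q j) =
      fun k : {k : Fin p // (k : ℕ) < q} => covX S j k := by
  rw [activeCoef, Matrix.mulVec_mulVec, Matrix.mul_nonsing_inv _
    ((Matrix.isUnit_iff_isUnit_det _).1 ((formBounds_activeCov h q).posDef hc).isUnit), Matrix.one_mulVec]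

/-- The covariance form at the regression residual (`-1` at `j`, `θ` on the active block) equals the
residual variance `1 - θᵀ C₁₁ θ ≤ 1`, while it is at least `c₁ (1 + ‖θ‖²)`. Inactivity of `j` keeps
the two index sets disjoint. -/
theorem vnorm_activeCoef_le (h : FormBounds S c₁ c₂) (hc : 0 < c₁) {q : ℕ} {j : Fin p}
    (hj : ¬ (j : ℕ) < q) (hjj : covX S j j = 1) :
    vnorm (activeCoef S q j) ≤ Real.sqrt (1 / c₁) := by
  set θ := activeCoef S q j with hθ
  set f : Option {k : Fin p // (k : ℕ) < q} → Fin p := fun o => o.elim j Subtype.val with hf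
  have hinj : Function.Injective f := by
    rintro (_ | a) (_ | b) hab
    · rfl
    · exact absurd (by rw [show j = b from hab]; exact b.2) hj
    · exact absurd (by rw [← show a = j from hab]; exact a.2) hj
    · exact congrArg some (Subtype.ext hab)
  have h1 := ((formBounds_covX h).submatrix hinj).lower (fun o => o.elim (-1) θ)
  have h2 := activeCov_mulVec_activeCoef h hc q j
  have h3 : linCov ((covX S).submatrix f f) (fun o => o.elim (-1) θ)
      (fun o => o.elim (-1) θ) = 1 - θ ⬝ᵥ (activeCov S q).mulVec θ := by
    have e1 : ∀ k : {k : Fin p // (k : ℕ) < q},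
        ∑ x : {k : Fin p // (k : ℕ) < q}, covX S k x * θ x = covX S j k := fun k => congrFun h2 k
    have e2 : ∀ k : {k : Fin p // (k : ℕ) < q}, covX S k j = covX S j k :=
      fun k => (formBounds_covX h).symm.apply _ _
    have e3 : ∑ x : {k : Fin p // (k : ℕ) < q}, covX S j x * θ x =
        ∑ x : {k : Fin p // (k : ℕ) < q}, θ x * covX S j x :=
      Finset.sum_congr rfl fun _ _ => mul_comm _ _
    rw [h2]
    simp only [linCov, dotProduct, Matrix.mulVec, Fintype.sum_option, hf, Matrix.submatrix_apply,
      Option.elim, hjj, e1, e2, e3]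
    simp
    ring
  have h4 := linCov_self_nonneg ((formBounds_activeCov h q).posDef hc).posSemidef θ
  rw [linCov] at h4
  have h5 : (fun o : Option {k : Fin p // (k : ℕ) < q} => o.elim (-1) θ) ⬝ᵥ
      (fun o => o.elim (-1) θ) = 1 + θ ⬝ᵥ θ := by
    simp [dotProduct, Fintype.sum_option]
  rw [h3, h5] at h1
  refine vnorm_le_of_dotProduct_le (Real.sqrt_nonneg _) ?_
  rw [Real.sq_sqrt (by positivity), le_div_iff₀ hc]
  linarith

/-- Symmetry of `C₁₁⁻¹` moves it from the sign vector to the row `C_j1`, which brings the condition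
into the form `θᵀ(w₀ s)` used by `exists_restricted_solution`. -/
theorem irrepVec_eq (h : FormBounds S c₁ c₂) (hc : 0 < c₁) {q : ℕ}
    (j : {j : Fin p // ¬ (j : ℕ) < q}) :
    irrepVec S q j = Real.sqrt (1 / precDiag S j) *
      (activeCoef S q j ⬝ᵥ ((fun k : {k : Fin p // (k : ℕ) < q} => Real.sqrt (precDiag S k)) *
        fun k : {k : Fin p // (k : ℕ) < q} => Real.sign (spac S k))) := by
  have hS := h.posDef hc
  have hV : (Matrix.diagonal
      (fun k : {k : Fin p // (k : ℕ) < q} => Real.sqrt (1 / precDiag S k)))⁻¹ =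
      Matrix.diagonal (fun k : {k : Fin p // (k : ℕ) < q} => Real.sqrt (precDiag S k)) := by
    refine Matrix.inv_eq_right_inv ?_
    rw [Matrix.diagonal_mul_diagonal, ← Matrix.diagonal_one]
    congr 1
    ext k
    have hd := precDiag_pos hS (k : Fin p)
    rw [← Real.sqrt_mul (by positivity), one_div_mul_cancel hd.ne', Real.sqrt_one]
  have hsymm : ((activeCov S q)⁻¹).IsSymm := by
    have := (formBounds_activeCov h q).symm
    rw [Matrix.IsSymm, Matrix.transpose_nonsing_inv, this.eq]
  rw [irrepVec, hV, ← Matrix.mulVec_mulVec, ← Matrix.mulVec_mulVec, ← Matrix.mulVec_mulVec,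
    Matrix.mulVec_diagonal]
  congr 1
  change (fun k : {k : Fin p // (k : ℕ) < q} => covX S j k) ⬝ᵥ
    (activeCov S q)⁻¹.mulVec _ = _
  rw [activeCoef, Matrix.dotProduct_mulVec, ← Matrix.mulVec_transpose, hsymm.eq]
  congr 1
  ext k
  rw [Matrix.mulVec_diagonal]
  rfl

end Irrepresentable

theorem card_fin_val_lt {p q : ℕ} (h : q ≤ p) : Fintype.card {k : Fin p // (k : ℕ) < q} = q := by
  rw [Fintype.card_congr (Fin.castLEquiv h).symm, Fintype.card_fin]

theorem sum_dite_eq_sum_subtype {ι : Type*} [Fintype ι] (P : ι → Prop) [DecidablePred P]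
    (f : {i // P i} → ℝ) : ∑ i, (if h : P i then f ⟨i, h⟩ else 0) = ∑ i, f i := by
  rw [← Fintype.sum_subtype_add_sum_subtype P, Finset.sum_eq_zero (s := Finset.univ)
    (f := fun i : {i // ¬ P i} => _), add_zero]
  · exact Finset.sum_congr rfl fun i _ => dif_pos i.2
  · exact fun i _ => dif_neg i.2

/-! ### The SPAC-Lasso on data with accurate moments -/

/-- The constant in the error bound for the restricted estimator. -/
noncomputable def restrictedConst (c₁ : ℝ) : ℝ := 2 * (Real.sqrt (1 / c₁) + 2) / c₁

theorem restrictedConst_pos {c₁ : ℝ} (hc : 0 < c₁) : 0 < restrictedConst c₁ := by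
  unfold restrictedConst; positivity

/-- The constant in the final error bounds. -/
noncomputable def errorConst (c₁ c₂ : ℝ) : ℝ :=
  2 * restrictedConst c₁ + 4 * Real.sqrt (c₂ / c₁)

section Deterministic

variable {n p q : ℕ} {S : Matrix (Option (Fin p)) (Option (Fin p)) ℝ} {β : Fin p → ℝ}
  {c₁ c₂ a : ℝ}

theorem vnorm_coef_le (hS : FormBounds S c₁ c₂) (hc : 0 < c₁)
    (hβ : ∀ k, linCov S (noiseCoef β) (Pi.single (some k) 1) = 0) :
    vnorm β ≤ Real.sqrt (c₂ / c₁) := by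
  have h := (linCov_noiseCoef_self hS hc hβ).1
  have h0 : 0 ≤ c₂ / c₁ := by
    refine div_nonneg (le_trans ?_ h) hc.le
    exact mul_nonneg hc.le (Finset.sum_nonneg fun i _ => mul_self_nonneg _)
  refine vnorm_le_of_dotProduct_le (Real.sqrt_nonneg _) ?_
  rw [Real.sq_sqrt h0, le_div_iff₀ hc]
  linarith

/-- Transfer of the estimation error from the coefficients to the SPACs. -/
theorem vnorm_div_sub_div_le {b w w₀ : Fin p → ℝ} (ha : a ≤ 1 / 2) (ha0 : 0 ≤ a)
    (hw : ∀ j, |w j - w₀ j| ≤ a) (hw₀ : ∀ j, 1 ≤ w₀ j) :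
    vnorm (fun j => b j / w j - β j / w₀ j) ≤ 2 * vnorm (b - β) + 2 * a * vnorm β := by
  have hwpos : ∀ j, 1 / 2 ≤ w j := fun j => by
    have := (abs_le.1 (hw j)).1
    linarith [hw₀ j]
  have hdec : (fun j => b j / w j - β j / w₀ j) =
      (fun j => (b j - β j) / w j) + fun j => β j * ((w₀ j - w j) / (w j * w₀ j)) := by
    ext j
    have h1 : w j ≠ 0 := by linarith [hwpos j]
    have h2 : w₀ j ≠ 0 := by linarith [hw₀ j]
    simp only [Pi.add_apply]
    field_simp
    ring
  rw [hdec]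
  refine (vnorm_add_le _ _).trans (add_le_add ?_ ?_)
  · refine vnorm_le_mul_of_abs_le (by norm_num) fun j => ?_
    have h1 := hwpos j
    rw [abs_div, abs_of_pos (by linarith : 0 < w j), div_le_iff₀ (by linarith), Pi.sub_apply]
    nlinarith [abs_nonneg (b j - β j)]
  · refine vnorm_le_mul_of_abs_le (by positivity) fun j => ?_
    have h1 := hwpos j
    have h2 := hw₀ j
    have h3 : 1 / 2 ≤ w j * w₀ j := by nlinarith
    have h4 : |(w₀ j - w j) / (w j * w₀ j)| ≤ 2 * a := by
      rw [abs_div, abs_of_pos (by linarith : 0 < w j * w₀ j), div_le_iff₀ (by linarith),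
        abs_sub_comm]
      nlinarith [hw j]
    rw [abs_mul, mul_comm]
    exact mul_le_mul_of_nonneg_right h4 (abs_nonneg _)

/-- On data with accurate moments the SPAC-Lasso has exactly one solution, which is close to the
vector of SPACs and has the same signs. -/
theorem exists_unique_lassoSolution (hn : 0 < n) (hq : 1 ≤ q) (hqp : q ≤ p)
    (hS : FormBounds S c₁ c₂) (hc : 0 < c₁) (hdiag : ∀ j, covX S j j = 1)
    (hβ : ∀ k, linCov S (noiseCoef β) (Pi.single (some k) 1) = 0)
    (hsparse : ∀ j, β j ≠ 0 ↔ (j : ℕ) < q) {η : ℝ} (hη : 0 < η)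
    (hirr : ∀ j, |irrepVec S q j| ≤ 1 - η) {l : ℝ}
    (hl : ∀ j : Fin p, (j : ℕ) < q → l ≤ |spac S j|)
    {Z : Matrix (Fin n) (Fin p) ℝ} {y : Fin n → ℝ} {dhat t : Fin p → ℝ} {lam ε : ℝ}
    (ha : 0 ≤ a) (ht : ∀ j, |t j - 1| ≤ a)
    (hG : ∀ j k, |(∑ i, Z i j * Z i k) / n - covX S j k| ≤ a)
    (hh : ∀ j, |(∑ i, Z i j * (y i - ∑ k, Z i k * (t k * β k))) / n| ≤ a)
    (hd : ∀ j, |dhat j - precDiag S j| ≤ a) (hlam : 0 < lam)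
    (hε1 : ε ≤ 1 / 2) (hεc : ε ≤ c₁ / 2)
    (hε : ε * (2 + restrictedConst c₁ + Real.sqrt (1 / c₁) * restrictedConst c₁ +
      2 * Real.sqrt (1 / c₁)) < η)
    (hsmall : q * Real.sqrt q * a ≤ ε) (hsmall' : Real.sqrt q * a ≤ ε * (lam / n))
    (hsig : restrictedConst c₁ * (Real.sqrt q * (lam / n)) < l / 2) :
    ∃ g, IsLassoSolution lam dhat Z y g ∧ ∀ g', IsLassoSolution lam dhat Z y g' →
      l2norm (g' - spac S) ≤ errorConst c₁ c₂ * (Real.sqrt q * (lam / n)) ∧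
      l2norm (betaOf dhat g' - β) ≤ errorConst c₁ c₂ * (Real.sqrt q * (lam / n)) ∧
      ∀ j, Real.sign (g' j) = Real.sign (spac S j) := by
  have hpd := hS.posDef hc
  have hspac := spac_eq hpd hβ
  have hn0 : (0 : ℝ) < n := Nat.cast_pos.2 hn
  set τ := lam / n with hτdef
  have hτ : 0 < τ := div_pos hlam hn0
  set B := Real.sqrt (1 / c₁) with hB
  set K := restrictedConst c₁ with hK
  set D := Real.sqrt (c₂ / c₁) with hD
  have hK0 : 0 < K := restrictedConst_pos hc
  have hq1 : (1 : ℝ) ≤ q := Nat.one_le_cast.2 hq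
  have hr1 : 1 ≤ Real.sqrt q := Real.one_le_sqrt.2 hq1
  have hra : a ≤ Real.sqrt q * a := le_mul_of_one_le_left ha hr1
  have haε : a ≤ ε := by
    have := mul_le_mul_of_nonneg_right hq1 (mul_nonneg (by linarith : 0 ≤ Real.sqrt q) ha)
    linarith
  have ha2 : a ≤ 1 / 2 := haε.trans hε1
  have haτ : a ≤ Real.sqrt q * τ := by nlinarith
  set w : Fin p → ℝ := fun j => Real.sqrt (dhat j) with hw
  set w₀ : Fin p → ℝ := fun j => Real.sqrt (precDiag S j) with hw₀
  have hd1 : ∀ j, 1 ≤ precDiag S j := fun j => one_le_precDiag hpd (hdiag j)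
  have hdhat : ∀ j, 0 < dhat j := fun j => by linarith [(abs_le.1 (hd j)).1, hd1 j]
  have hwpos : ∀ j, 0 < w j := fun j => Real.sqrt_pos.2 (hdhat j)
  have hw₀1 : ∀ j, 1 ≤ w₀ j := fun j => Real.one_le_sqrt.2 (hd1 j)
  have hw₀pos : ∀ j, 0 < w₀ j := fun j => one_pos.trans_le (hw₀1 j)
  have hww : ∀ j, |w j - w₀ j| ≤ a := fun j =>
    (abs_sqrt_sub_sqrt_le (hdhat j).le (hd1 j)).trans (hd j)
  have hw₀B : ∀ j, |w₀ j| ≤ B := fun j => by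
    rw [abs_of_pos (hw₀pos j)]
    exact Real.sqrt_le_sqrt (precDiag_le hS hc j)
  have htpos : ∀ j, 1 / 2 ≤ t j := fun j => by linarith [(abs_le.1 (ht j)).1]
  have hsign : ∀ j, Real.sign (spac S j) = Real.sign (β j) := fun j => by
    rw [hspac, div_eq_mul_inv, sign_mul_of_pos _ (inv_pos.2 (hw₀pos j))]
  -- `G` is the Gram matrix of the design and `H` the normalized score at the scaled target `t β`.
  -- The witness will be `t β + δ` with `δ` supported on the active set.
  set G : Matrix (Fin p) (Fin p) ℝ := fun j k => (∑ i, Z i j * Z i k) / n with hGdef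
  set H : Fin p → ℝ := fun j => (∑ i, Z i j * (y i - ∑ k, Z i k * (t k * β k))) / n with hHdef
  have hcardA := card_fin_val_lt hqp
  have hGA : ∀ j k : {k : Fin p // (k : ℕ) < q},
      |G.submatrix Subtype.val Subtype.val j k - activeCov S q j k| ≤ a := fun j k => hG j k
  have hirr' : ∀ j : {j : Fin p // ¬ (j : ℕ) < q}, |activeCoef S q j ⬝ᵥ
      ((fun k : {k : Fin p // (k : ℕ) < q} => w₀ k) * fun k : {k : Fin p // (k : ℕ) < q} => Real.sign (β k))| ≤
      (1 - η) * w₀ j := by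
    intro j
    have h1 := hirr j
    have h2 : Real.sqrt (1 / precDiag S j) = (w₀ j)⁻¹ := by rw [one_div, Real.sqrt_inv]
    rw [irrepVec_eq hS hc j, h2, abs_mul, abs_of_pos (inv_pos.2 (hw₀pos j)),
      inv_mul_le_iff₀ (hw₀pos j)] at h1
    simp only [hsign] at h1
    exact h1.trans_eq (mul_comm _ _)
  obtain ⟨Δ, hΔ, hΔn, hdual⟩ := exists_restricted_solution
    (κ := {j : Fin p // ¬ (j : ℕ) < q}) (C := activeCov S q)
    (G := G.submatrix Subtype.val Subtype.val)
    (g := fun j k => G j k) (c := fun j k => covX S j k) (θ := fun j => activeCoef S q j)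
    (h₁ := fun k => H k) (h₂ := fun j => H j) (s := fun k => Real.sign (β k))
    (w := fun k => w k) (w₀ := fun k => w₀ k) (v := fun j => w j) (v₀ := fun j => w₀ j)
    (τ := τ) (B := B) (η := η) (ε := ε) (a := a)
    (formBounds_activeCov hS q).lower (formBounds_activeCov hS q).symm hc ha hτ
    (Real.sqrt_nonneg _) (by rw [hcardA]; exact hq) hGA (fun j k => hG j k) (fun k => hh k)
    (fun j => hh j) (fun k => abs_sign_le_one _) (fun k => hww k) (fun k => hw₀B k)
    (fun j => by linarith [(abs_le.1 (hww j)).1]) (fun j => hw₀1 j)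
    (fun j => activeCov_mulVec_activeCoef hS hc q j)
    (fun j => vnorm_activeCoef_le hS hc j.2 (hdiag j))
    hirr' hη (by linarith) hεc hε (by rw [hcardA]; exact hsmall)
    (by rw [hcardA]; exact hsmall')
  rw [hcardA] at hΔn
  set δ : Fin p → ℝ := fun j => if h : (j : ℕ) < q then Δ ⟨j, h⟩ else 0 with hδ
  have hδA : ∀ k : {k : Fin p // (k : ℕ) < q}, δ k = Δ k := fun k => dif_pos k.2
  have hδ0 : ∀ j : Fin p, ¬ (j : ℕ) < q → δ j = 0 := fun j hj => dif_neg hj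
  have hsumA : ∀ (x : Fin p → ℝ) (j : Fin p), (∀ k : Fin p, ¬ (k : ℕ) < q → x k = 0) →
      ∑ k, G j k * x k = ∑ k : {k : Fin p // (k : ℕ) < q}, G j k * x k := by
    intro x j hx
    rw [← sum_dite_eq_sum_subtype (fun k : Fin p => (k : ℕ) < q) fun k => G j k * x k]
    refine Finset.sum_congr rfl fun k _ => ?_
    by_cases hk : (k : ℕ) < q
    · rw [dif_pos hk]
    · rw [dif_neg hk, hx k hk, mul_zero]
  have hGδ : ∀ j, ∑ k, G j k * δ k = (fun k : {k : Fin p // (k : ℕ) < q} => G j k) ⬝ᵥ Δ := by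
    intro j
    rw [hsumA δ j hδ0]
    exact Finset.sum_congr rfl fun k _ => by rw [hδA]
  have hδn : vnorm δ ≤ K * (Real.sqrt q * τ) := by
    refine le_trans (le_of_eq ?_) hΔn
    rw [← pow_left_inj₀ (vnorm_nonneg _) (vnorm_nonneg _) two_ne_zero, vnorm_sq, vnorm_sq,
      dotProduct, dotProduct,
      ← sum_dite_eq_sum_subtype (fun k : Fin p => (k : ℕ) < q) fun k => Δ k * Δ k]
    refine Finset.sum_congr rfl fun k _ => ?_
    by_cases hk : (k : ℕ) < q <;> simp [hδ, hk]
  have hβ0 : ∀ j : Fin p, ¬ (j : ℕ) < q → β j = 0 := fun j hj => by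
    by_contra hne
    exact hj ((hsparse j).1 hne)
  set b : Fin p → ℝ := fun j => t j * β j + δ j with hb
  have hbsign : ∀ j, Real.sign (b j) = Real.sign (β j) := by
    intro j
    by_cases hj : (j : ℕ) < q
    · have htj : 0 < t j := by linarith [htpos j]
      rw [hb, ← sign_mul_of_pos (β j) htj, mul_comm (β j)]
      -- `|δ_j| < l/2 ≤ |γ_j|/2 ≤ |β_j|/2 ≤ t_j |β_j|`, where `|γ_j| ≤ |β_j|` because `d_jj ≥ 1`.
      refine sign_add_of_abs_lt ?_
      have h1 : |δ j| < l / 2 := ((abs_apply_le_vnorm δ j).trans hδn).trans_lt hsig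
      have h2 : |spac S j| ≤ |β j| := by
        rw [hspac, abs_div, abs_of_pos (hw₀pos j)]
        exact div_le_self (abs_nonneg _) (hw₀1 j)
      rw [abs_mul, abs_of_pos htj]
      nlinarith [hl j hj, htpos j, abs_nonneg (β j)]
    · simp [hb, hβ0 j hj, hδ0 j hj]
  set g : Fin p → ℝ := fun j => b j / w j with hg
  -- The dual certificate: prescribed signs on the active set, and elsewhere the value that
  -- stationarity dictates, whose strict bound is `hdual`.
  set z : Fin p → ℝ := fun j =>
    if (j : ℕ) < q then Real.sign (β j) else (H j - ∑ k, G j k * δ k) / (τ * w j) with hz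
  have hres : ∀ j, ∑ i, Z i j * (y i - ∑ k, Z i k * Real.sqrt (dhat k) * g k) =
      n * (H j - ∑ k, G j k * δ k) := by
    intro j
    have h1 : ∀ i, y i - ∑ k, Z i k * Real.sqrt (dhat k) * g k =
        (y i - ∑ k, Z i k * (t k * β k)) - ∑ k, Z i k * δ k := by
      intro i
      rw [sub_sub, ← Finset.sum_add_distrib]
      congr 1
      refine Finset.sum_congr rfl fun k _ => ?_
      have h2 : w k ≠ 0 := (hwpos k).ne'
      change Z i k * w k * (b k / w k) = _
      rw [mul_assoc, mul_div_cancel₀ _ h2]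
      ring
    have h3 : (n : ℝ) * ∑ k, G j k * δ k = ∑ i, Z i j * ∑ k, Z i k * δ k := by
      simp only [hGdef, Finset.mul_sum, Finset.sum_div, Finset.sum_mul]
      rw [Finset.sum_comm]
      refine Finset.sum_congr rfl fun i _ => Finset.sum_congr rfl fun k _ => ?_
      field_simp
    rw [mul_sub, h3, hHdef]
    simp only [h1, mul_sub, Finset.sum_sub_distrib]
    field_simp
  have hlamτ : lam = n * τ := by rw [hτdef]; field_simp
  have hkkt : ∀ j, ∑ i, Z i j * (y i - ∑ k, Z i k * Real.sqrt (dhat k) * g k) =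
      lam * (Real.sqrt (dhat j) * z j) := by
    intro j
    rw [hres, hlamτ, mul_assoc]
    congr 1
    by_cases hj : (j : ℕ) < q
    · have h1 := congrFun hΔ ⟨j, hj⟩
      have h2 : (G.submatrix (Subtype.val (p := fun k : Fin p => (k : ℕ) < q)) Subtype.val).mulVec Δ
          ⟨j, hj⟩ =
          (fun k : {k : Fin p // (k : ℕ) < q} => G j k) ⬝ᵥ Δ := rfl
      rw [h2, ← hGδ] at h1
      simp only [Pi.sub_apply, Pi.smul_apply, Pi.mul_apply, smul_eq_mul] at h1
      rw [h1, hz]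
      simp only [if_pos hj]
      change _ = τ * (w j * _)
      ring
    · simp only [hz, if_neg hj]
      change _ = τ * (w j * _)
      have := (hwpos j).ne'
      field_simp
  have hzlt : ∀ j : Fin p, ¬ (j : ℕ) < q → |z j| < 1 := by
    intro j hj
    have h1 := hdual ⟨j, hj⟩
    rw [← hGδ] at h1
    simp only [hz, if_neg hj]
    have h2 : 0 < τ * w j := mul_pos hτ (hwpos j)
    rw [abs_div, abs_of_pos h2, div_lt_one h2]
    exact h1
  have hzle : ∀ j, |z j| ≤ 1 := by
    intro j
    by_cases hj : (j : ℕ) < q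
    · simp only [hz, if_pos hj]; exact abs_sign_le_one _
    · exact (hzlt j hj).le
  have hgsign : ∀ j, Real.sign (g j) = Real.sign (β j) := fun j => by
    rw [← hbsign j]
    simp only [hg, div_eq_mul_inv]
    exact sign_mul_of_pos _ (inv_pos.2 (hwpos j))
  have hzg : ∀ j, z j * g j = |g j| := by
    intro j
    by_cases hj : (j : ℕ) < q
    · simp only [hz, if_pos hj]
      rw [← hgsign, sign_mul_self_eq_abs]
    · simp [hg, hb, hβ0 j hj, hδ0 j hj]
  have hinj : ∀ x : Fin p → ℝ, (∀ j : Fin p, ¬ (j : ℕ) < q → x j = 0) →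
      (∀ i, ∑ j, Z i j * x j = 0) → ∀ j, x j = 0 := by
    intro x hx0 hZx
    have h1 : ∀ j, ∑ k, G j k * x k = 0 := by
      intro j
      have h3 : (n : ℝ) * ∑ k, G j k * x k = ∑ i, Z i j * ∑ k, Z i k * x k := by
        simp only [hGdef, Finset.mul_sum, Finset.sum_div, Finset.sum_mul]
        rw [Finset.sum_comm]
        refine Finset.sum_congr rfl fun i _ => Finset.sum_congr rfl fun k _ => ?_
        field_simp
      simp only [hZx, mul_zero, Finset.sum_const_zero] at h3
      exact (mul_eq_zero.1 h3).resolve_left hn0.ne'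
    have h2 : (fun k : {k : Fin p // (k : ℕ) < q} => x k) = 0 := by
      refine eq_zero_of_mulVec_eq_zero (G := G.submatrix Subtype.val Subtype.val)
        (formBounds_activeCov hS q).lower hc ha hGA ?_ ?_
      · rw [hcardA]
        refine le_trans ?_ (hsmall.trans hεc)
        have := mul_le_mul_of_nonneg_left hra (by linarith : (0 : ℝ) ≤ q)
        linarith
      · ext j
        have := h1 j
        rw [hsumA x j hx0] at this
        exact this
    intro j
    by_cases hj : (j : ℕ) < q
    · exact congrFun h2 ⟨j, hj⟩
    · exact hx0 j hj
  have huniq := isLassoSolution_iff_eq hlam hdhat hkkt hzg hzle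
    (P := fun j : Fin p => (j : ℕ) < q) hzlt hinj
  have hβn : vnorm β ≤ D := vnorm_coef_le hS hc hβ
  have hD0 : 0 ≤ D := Real.sqrt_nonneg _
  have hbn : vnorm (b - β) ≤ (K + D) * (Real.sqrt q * τ) := by
    -- The bias from rescaling the columns is at most `a ‖β‖`, which is absorbed since `a ≤ √q τ`.
    have h1 : b - β = (fun j => (t j - 1) * β j) + δ := by
      ext j
      simp only [hb, Pi.sub_apply, Pi.add_apply]
      ring
    have h2 : vnorm (fun j => (t j - 1) * β j) ≤ a * vnorm β :=
      vnorm_le_mul_of_abs_le ha fun j => by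
        rw [abs_mul]; exact mul_le_mul_of_nonneg_right (ht j) (abs_nonneg _)
    have h3 : a * vnorm β ≤ Real.sqrt q * τ * D :=
      mul_le_mul haτ hβn (vnorm_nonneg _) (by positivity)
    rw [h1]
    refine (vnorm_add_le _ _).trans ?_
    linarith
  have hbeta : betaOf dhat g = b := by
    ext j
    exact div_mul_cancel₀ _ (hwpos j).ne'
  refine ⟨g, (huniq g).2 rfl, fun g' hg' => ?_⟩
  rw [(huniq g').1 hg', errorConst]
  have hqτ : 0 ≤ Real.sqrt q * τ := by positivity
  refine ⟨?_, ?_, fun j => by rw [hgsign, hsign]⟩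
  · have h1 : g - spac S = fun j => b j / w j - β j / w₀ j := by
      ext j
      simp only [Pi.sub_apply, hspac, hg, hw₀]
    -- Twice the coefficient error `(K + D) √q τ` plus `2 D √q τ` from the estimated weights adds up
    -- to `2K + 4D`, the value of `errorConst`.
    have h2 := vnorm_div_sub_div_le (b := b) (β := β) ha2 ha hww hw₀1
    have h3 : 2 * a * vnorm β ≤ 2 * (Real.sqrt q * τ) * D :=
      mul_le_mul (by linarith) hβn (vnorm_nonneg _) (by positivity)
    rw [h1]
    change vnorm _ ≤ _
    linarith
  · rw [hbeta]
    change vnorm _ ≤ _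
    refine hbn.trans (mul_le_mul_of_nonneg_right ?_ hqτ)
    linarith

end Deterministic

/-! ### Gram matrices of the raw and the standardized design -/

section Design

variable {n p : ℕ} {C : Matrix (Fin p) (Fin p) ℝ} {β : Fin p → ℝ} {X : Matrix (Fin n) (Fin p) ℝ}
  {y : Fin n → ℝ} {a : ℝ}

theorem abs_div_le_of_abs_le_mul {x m c : ℝ} (hm : 0 < m) (h : |x| ≤ m * c) : |x / m| ≤ c := by
  rwa [abs_div, abs_of_pos hm, div_le_iff₀ hm, mul_comm c]

theorem MomentsAccurate.gram_raw (h : MomentsAccurate C β X y a) (hn : 0 < n) (j k : Fin p) :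
    |(∑ i, X i j * X i k) / n - C j k| ≤ a := by
  have hn0 : (0 : ℝ) < n := Nat.cast_pos.2 hn
  have h1 := abs_div_le_of_abs_le_mul hn0 (h.gram j k)
  rwa [sub_div, mul_div_cancel_left₀ _ hn0.ne'] at h1

theorem MomentsAccurate.cross_raw (h : MomentsAccurate C β X y a) (hn : 0 < n) (j : Fin p) :
    |(∑ i, X i j * (y i - ∑ k, X i k * (1 * β k))) / n| ≤ a := by
  simp only [one_mul]
  exact abs_div_le_of_abs_le_mul (Nat.cast_pos.2 hn) (h.cross j)

theorem sum_center_mul_center (hn : 0 < n) (j k : Fin p) :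
    (∑ i, (X i j - colMean X j) * (X i k - colMean X k)) / n =
      (∑ i, X i j * X i k) / n - colMean X j * colMean X k := by
  have hn0 : (n : ℝ) ≠ 0 := Nat.cast_ne_zero.2 hn.ne'
  have hm : ∀ j, ∑ i, X i j = n * colMean X j := fun j => by
    rw [colMean]; field_simp
  have h1 : ∑ i, (X i j - colMean X j) * (X i k - colMean X k) =
      ∑ i, X i j * X i k - n * (colMean X j * colMean X k) := by
    calc _ = ∑ i, (X i j * X i k - X i j * colMean X k - colMean X j * X i k +
            colMean X j * colMean X k) := Finset.sum_congr rfl fun i _ => by ring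
      _ = _ := by
          rw [Finset.sum_add_distrib, Finset.sum_sub_distrib, Finset.sum_sub_distrib,
            ← Finset.sum_mul, ← Finset.mul_sum, hm, hm]
          simp
          ring
  rw [h1]
  field_simp

theorem MomentsAccurate.abs_colMean_le (h : MomentsAccurate C β X y a) (hn : 0 < n) (j : Fin p) :
    |colMean X j| ≤ a :=
  abs_div_le_of_abs_le_mul (Nat.cast_pos.2 hn) (h.mean j)

/-- The squared standard deviation is the Gram diagonal minus a squared mean, each off by at most
`a`, and the square root contracts distances to 1. -/
theorem MomentsAccurate.abs_colSd_sub_one_le (h : MomentsAccurate C β X y a) (hn : 0 < n)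
    (ha : 0 ≤ a) (ha1 : a ≤ 1 / 4) (hC : ∀ j, C j j = 1) (j : Fin p) :
    |colSd X j - 1| ≤ 2 * a := by
  have h1 := h.gram_raw hn j j
  have h2 := h.abs_colMean_le hn j
  rw [hC] at h1
  have h3 : |(∑ i, (X i j - colMean X j) ^ 2) / n - 1| ≤ 2 * a := by
    have h4 := sum_center_mul_center (X := X) hn j j
    simp only [← sq] at h4
    rw [h4]
    have h5 : colMean X j ^ 2 ≤ a := by
      rw [← sq_abs]
      nlinarith [abs_nonneg (colMean X j)]
    have h6 := sq_nonneg (colMean X j)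
    simp only [← sq] at h1
    obtain ⟨h7, h8⟩ := abs_le.1 h1
    exact abs_le.2 ⟨by linarith, by linarith⟩
  have h5 : 0 ≤ (∑ i, (X i j - colMean X j) ^ 2) / n :=
    div_nonneg (Finset.sum_nonneg fun _ _ => sq_nonneg _) n.cast_nonneg
  have h6 := abs_sqrt_sub_sqrt_le h5 le_rfl
  rw [Real.sqrt_one] at h6
  exact h6.trans h3

theorem sum_standardize_mul (j k : Fin p) :
    ∑ i, standardize X i j * standardize X i k =
      (∑ i, (X i j - colMean X j) * (X i k - colMean X k)) / (colSd X j * colSd X k) := by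
  rw [Finset.sum_div]
  exact Finset.sum_congr rfl fun i _ => by simp only [standardize, Matrix.of_apply, div_mul_div_comm]

/-- The numerator is off by `2a`, the product of the scales by `5a` and is at least `1/4`, giving
`28a`. The value 40 is a roomy constant shared by all estimates of the design. -/
theorem MomentsAccurate.gram_standardize (h : MomentsAccurate C β X y a) (hn : 0 < n)
    (ha : 0 ≤ a) (ha1 : a ≤ 1 / 4) (hC : ∀ j, C j j = 1) (hC1 : ∀ j k, |C j k| ≤ 1)
    (j k : Fin p) :
    |(∑ i, standardize X i j * standardize X i k) / n - C j k| ≤ 40 * a := by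
  obtain ⟨s1, s2⟩ := abs_le.1 (h.abs_colSd_sub_one_le hn ha ha1 hC j)
  obtain ⟨t1, t2⟩ := abs_le.1 (h.abs_colSd_sub_one_le hn ha ha1 hC k)
  set s := colSd X j
  set t := colSd X k
  have hs : 1 / 2 ≤ s := by linarith
  have ht : 1 / 2 ≤ t := by linarith
  have hst : 1 / 4 ≤ s * t := by nlinarith
  have hst1 : |s * t - 1| ≤ 5 * a := by
    have h1 : s * t - 1 = (s - 1) * (t - 1) + (s - 1) + (t - 1) := by ring
    have h2 : |(s - 1) * (t - 1)| ≤ 2 * a * (1 / 2) := by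
      rw [abs_mul]
      exact mul_le_mul (abs_le.2 ⟨by linarith, by linarith⟩)
        (abs_le.2 ⟨by linarith, by linarith⟩) (abs_nonneg _) (by linarith)
    obtain ⟨h3, h4⟩ := abs_le.1 h2
    rw [h1]
    exact abs_le.2 ⟨by linarith, by linarith⟩
  rw [sum_standardize_mul, div_right_comm, sum_center_mul_center hn]
  set N := (∑ i, X i j * X i k) / n - colMean X j * colMean X k with hN
  have hN1 : |N - C j k| ≤ 2 * a := by
    have h1 := abs_le.1 (h.gram_raw hn j k)
    have h2 : |colMean X j * colMean X k| ≤ a * 1 := by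
      rw [abs_mul]
      exact mul_le_mul (h.abs_colMean_le hn j) ((h.abs_colMean_le hn k).trans (by linarith))
        (abs_nonneg _) ha
    obtain ⟨h3, h4⟩ := abs_le.1 h2
    exact abs_le.2 ⟨by linarith [h1.1], by linarith [h1.2]⟩
  have h1 : N / (s * t) - C j k = ((N - C j k) - C j k * (s * t - 1)) / (s * t) := by
    have : s * t ≠ 0 := by linarith
    field_simp
    ring
  have h2 : |C j k * (s * t - 1)| ≤ 1 * (5 * a) := by
    rw [abs_mul]
    exact mul_le_mul (hC1 j k) hst1 (abs_nonneg _) zero_le_one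
  rw [h1]
  refine abs_div_le_of_abs_le_mul (by linarith) ?_
  refine (abs_sub _ _).trans ?_
  nlinarith

/-- With the coefficients rescaled by the column standard deviations, the residual is the noise plus
the constant `∑ mean_k β_k`. Centred columns annihilate that constant, so `y` itself need not be
centred. -/
theorem MomentsAccurate.cross_standardize (h : MomentsAccurate C β X y a) (hn : 0 < n)
    (ha : 0 ≤ a) (ha1 : a ≤ 1 / 4) (hC : ∀ j, C j j = 1) (j : Fin p) :
    |(∑ i, standardize X i j * (y i - ∑ k, standardize X i k * (colSd X k * β k))) / n| ≤
      40 * a := by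
  have hn0 : (0 : ℝ) < n := Nat.cast_pos.2 hn
  have hsd : ∀ k, 1 / 2 ≤ colSd X k := fun k => by
    linarith [(abs_le.1 (h.abs_colSd_sub_one_le hn ha ha1 hC k)).1]
  set m := (∑ i, noise β X y i) / n with hm
  have hm1 : |m| ≤ a := abs_div_le_of_abs_le_mul hn0 h.mean_noise
  have hres : ∀ i, y i - ∑ k, standardize X i k * (colSd X k * β k) =
      noise β X y i + ∑ k, colMean X k * β k := by
    intro i
    rw [noise, sub_add, ← Finset.sum_sub_distrib]
    congr 1
    refine Finset.sum_congr rfl fun k _ => ?_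
    have := hsd k
    simp only [standardize, Matrix.of_apply]
    rw [← mul_assoc, div_mul_cancel₀ _ (by linarith)]
    ring
  have hcenter : ∑ i, (X i j - colMean X j) = 0 := by
    rw [Finset.sum_sub_distrib]
    simp [colMean]
    field_simp
    simp
  have hsum : (∑ i, standardize X i j * (y i - ∑ k, standardize X i k * (colSd X k * β k))) / n =
      ((∑ i, X i j * noise β X y i) / n - colMean X j * m) / colSd X j := by
    have h1 : ∀ i, standardize X i j * (y i - ∑ k, standardize X i k * (colSd X k * β k)) =
        (X i j * noise β X y i - colMean X j * noise β X y i +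
          (X i j - colMean X j) * ∑ k, colMean X k * β k) / colSd X j := by
      intro i
      rw [hres]
      simp only [standardize, Matrix.of_apply]
      ring
    simp only [h1]
    rw [← Finset.sum_div, Finset.sum_add_distrib, ← Finset.sum_mul, hcenter, zero_mul, add_zero,
      Finset.sum_sub_distrib, ← Finset.mul_sum, div_right_comm, hm, sub_div, mul_div_assoc]
  have h1 : |(∑ i, X i j * noise β X y i) / n| ≤ a :=
    abs_div_le_of_abs_le_mul hn0 (h.cross j)
  have h2 : |colMean X j * m| ≤ a * 1 := by
    rw [abs_mul]
    exact mul_le_mul (h.abs_colMean_le hn j) (hm1.trans (by linarith)) (abs_nonneg _) ha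
  rw [hsum]
  refine abs_div_le_of_abs_le_mul (by linarith [hsd j]) ((abs_sub _ _).trans ?_)
  nlinarith [hsd j]

theorem abs_covX_le_one {S : Matrix (Option (Fin p)) (Option (Fin p)) ℝ} (hS : S.PosDef)
    (hdiag : ∀ j, covX S j j = 1) (j k : Fin p) : |covX S j k| ≤ 1 := by
  have hC := (posDef_covX hS).posSemidef
  have hs := (isSymm_of_posSemidef hC).apply j k
  have h1 := linCov_self_nonneg hC (Pi.single j 1 + Pi.single k 1)
  have h2 := linCov_self_nonneg hC (Pi.single j 1 - Pi.single k 1)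
  rw [linCov_add_left, linCov_add_right, linCov_add_right] at h1
  rw [linCov_sub_left, linCov_sub_right, linCov_sub_right] at h2
  simp [linCov, hdiag, hs] at h1 h2
  exact abs_le.2 ⟨by linarith, by linarith⟩

/-- Both choices of the design matrix have accurate second moments. -/
theorem MomentsAccurate.exists_scale (h : MomentsAccurate C β X y a) (hn : 0 < n)
    (ha : 0 ≤ a) (ha1 : a ≤ 1 / 4) (hC : ∀ j, C j j = 1) (hC1 : ∀ j k, |C j k| ≤ 1)
    {Z : Matrix (Fin n) (Fin p) ℝ} (hZ : Z = X ∨ Z = standardize X) :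
    ∃ t : Fin p → ℝ, (∀ j, |t j - 1| ≤ 40 * a) ∧
      (∀ j k, |(∑ i, Z i j * Z i k) / n - C j k| ≤ 40 * a) ∧
      ∀ j, |(∑ i, Z i j * (y i - ∑ k, Z i k * (t k * β k))) / n| ≤ 40 * a := by
  rcases hZ with rfl | rfl
  · exact ⟨fun _ => 1, fun j => by simpa using ha,
      fun j k => (h.gram_raw hn j k).trans (by linarith),
      fun j => (h.cross_raw hn j).trans (by linarith)⟩
  · exact ⟨colSd X, fun j => (h.abs_colSd_sub_one_le hn ha ha1 hC j).trans (by linarith),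
      h.gram_standardize hn ha ha1 hC hC1, h.cross_standardize hn ha ha1 hC⟩

end Design

/-! ### Rates -/

theorem EigenvaluesBounded.exists_formBounds {p : ℕ → ℕ}
    {S : ∀ n, Matrix (Option (Fin (p n))) (Option (Fin (p n))) ℝ} (h : EigenvaluesBounded S) :
    ∃ c₁ c₂ : ℝ, 0 < c₁ ∧ c₁ ≤ c₂ ∧ ∀ n, FormBounds (S n) c₁ c₂ := by
  obtain ⟨c₁, c₂, hc, hcc, hS⟩ := h
  refine ⟨c₁, c₂, hc, hcc, fun n => ?_⟩
  obtain ⟨hH, he⟩ := hS n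
  exact ⟨by simpa [Matrix.IsHermitian, Matrix.IsSymm] using hH,
    fun u => (linCov_bounds_of_eigenvalues hH he u).1,
    fun u => (linCov_bounds_of_eigenvalues hH he u).2⟩

/-- The squared claim is `q³ log n / n ≤ ε²`, the cube of the hypothesis with constant `(ε²)^(1/3)`.
-/
theorem eventually_sparsity_mul_rate_le {q : ℕ → ℕ}
    (hq : (fun n => (q n : ℝ)) =o[atTop] fun n : ℕ => ((n : ℝ) / Real.log n) ^ (1 / 3 : ℝ))
    {ε : ℝ} (hε : 0 < ε) :
    ∀ᶠ n : ℕ in atTop, q n * Real.sqrt (q n) * Real.sqrt (Real.log n / n) ≤ ε := by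
  set c : ℝ := (ε ^ 2) ^ (1 / 3 : ℝ) with hc
  have hc0 : 0 < c := Real.rpow_pos_of_pos (by positivity) _
  have hcube : ∀ x : ℝ, 0 ≤ x → (x ^ (1 / 3 : ℝ)) ^ 3 = x := fun x hx => by
    rw [← Real.rpow_natCast, ← Real.rpow_mul hx]
    norm_num
  filter_upwards [hq.def hc0, eventually_ge_atTop 2] with n hn hn2
  have hn0 : (0 : ℝ) < n := by positivity
  have hlog : 0 < Real.log n := Real.log_pos (by exact_mod_cast hn2)
  have hdiv : 0 < (n : ℝ) / Real.log n := by positivity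
  rw [Real.norm_of_nonneg (Nat.cast_nonneg _), Real.norm_of_nonneg (by positivity)] at hn
  have h1 : (q n : ℝ) ^ 3 ≤ ε ^ 2 * (n / Real.log n) := by
    calc (q n : ℝ) ^ 3 ≤ (c * (n / Real.log n) ^ (1 / 3 : ℝ)) ^ 3 := by gcongr
      _ = ε ^ 2 * (n / Real.log n) := by
        rw [mul_pow, hc, hcube _ (by positivity), hcube _ hdiv.le]
  refine abs_le_of_sq_le_sq' ?_ hε.le |>.2
  rw [mul_pow, mul_pow, Real.sq_sqrt (Nat.cast_nonneg _), Real.sq_sqrt (by positivity)]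
  calc (q n : ℝ) ^ 2 * q n * (Real.log n / n) = (q n : ℝ) ^ 3 * (Real.log n / n) := by ring
    _ ≤ ε ^ 2 * (n / Real.log n) * (Real.log n / n) := by gcongr
    _ = ε ^ 2 := by field_simp

theorem eventually_rate_le_lam {q : ℕ → ℕ} (hq : ∀ n, 1 ≤ q n) {lam : ℕ → ℝ}
    (hlam : ∀ n, 0 ≤ lam n)
    (h : (fun n : ℕ => Real.sqrt (q n * n * Real.log n)) =o[atTop] lam) {ε : ℝ} (hε : 0 < ε) :
    ∀ᶠ n : ℕ in atTop, 0 < lam n ∧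
      Real.sqrt (q n) * Real.sqrt (Real.log n / n) ≤ ε * (lam n / n) := by
  filter_upwards [h.def hε, eventually_ge_atTop 2] with n hn hn2
  have hn0 : (0 : ℝ) < n := by positivity
  have hlog : 0 < Real.log n := Real.log_pos (by exact_mod_cast hn2)
  have hq0 : (0 : ℝ) < q n := Nat.cast_pos.2 (hq n)
  rw [Real.norm_of_nonneg (Real.sqrt_nonneg _), Real.norm_of_nonneg (hlam n)] at hn
  have h1 : 0 < Real.sqrt (q n * n * Real.log n) := Real.sqrt_pos.2 (by positivity)
  refine ⟨pos_of_mul_pos_right (h1.trans_le hn) hε.le, ?_⟩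
  rw [← mul_div_assoc, le_div_iff₀ hn0]
  refine le_trans (le_of_eq ?_) hn
  have h2 : q n * n * Real.log n = q n * (Real.log n / n) * (n : ℝ) ^ 2 := by field_simp
  rw [h2, Real.sqrt_mul (by positivity), Real.sqrt_mul hq0.le, Real.sqrt_sq hn0.le]

/-- The `O(n^(2κ))` events of the union bound are paid for by the extra `2κ` in the exponent. -/
theorem isBigO_union_bound {p : ℕ → ℕ} (hp : ∀ n, 1 ≤ p n) {κ δ : ℝ}
    (hp_rate : (fun n => (p n : ℝ)) =O[atTop] fun n : ℕ => (n : ℝ) ^ κ) :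
    (fun n : ℕ => 6 * ((p n : ℝ) + 1) ^ 2 * Real.exp (-((δ + 2 * κ) * Real.log n))) =O[atTop]
      fun n : ℕ => (n : ℝ) ^ (-δ) := by
  have h1 : (fun n => (p n : ℝ) + 1) =O[atTop] fun n : ℕ => (n : ℝ) ^ κ := by
    refine IsBigO.trans (IsBigO.of_bound 2 (Eventually.of_forall fun n => ?_)) hp_rate
    have : (1 : ℝ) ≤ p n := Nat.one_le_cast.2 (hp n)
    rw [Real.norm_of_nonneg (by positivity), Real.norm_of_nonneg (by positivity)]
    linarith
  have h2 := ((h1.pow 2).const_mul_left 6).mul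
    (isBigO_refl (fun n : ℕ => Real.exp (-((δ + 2 * κ) * Real.log n))) atTop)
  refine h2.congr' EventuallyEq.rfl ?_
  filter_upwards [eventually_gt_atTop 0] with n hn
  have hn0 : (0 : ℝ) < n := Nat.cast_pos.2 hn
  have h3 : Real.exp (-((δ + 2 * κ) * Real.log n)) = (n : ℝ) ^ (-(δ + 2 * κ)) := by
    rw [Real.rpow_def_of_pos hn0]
    ring_nf
  rw [h3, sq, ← Real.rpow_add hn0, ← Real.rpow_add hn0]
  ring_nf

end SPAC

/-! ### Choice of constants and assembly -/

theorem theorem3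
    {Ω : ℕ → Type*} [∀ n, MeasurableSpace (Ω n)]
    (μ : ∀ n, Measure (Ω n)) [∀ n, IsProbabilityMeasure (μ n)]
    (p q : ℕ → ℕ) (hq : ∀ n, 1 ≤ q n) (hqp : ∀ n, q n ≤ p n)
    -- population parameters: covariance matrix, coefficients and noise variance
    (S : ∀ n, Matrix (Option (Fin (p n))) (Option (Fin (p n))) ℝ)
    (β : ∀ n, Fin (p n) → ℝ) (v : ℕ → ℝ≥0)
    (hvar : ∀ n j, SPAC.covX (S n) j j = 1)
    (hsparse : ∀ n j, β n j ≠ 0 ↔ (j : ℕ) < q n)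
    -- the data and the design matrix that is used for the estimation
    (X : ∀ n, Ω n → Matrix (Fin n) (Fin (p n)) ℝ) (y : ∀ n, Ω n → Fin n → ℝ)
    (hmodel : ∀ n, SPAC.IsGaussianLinearModel (μ n) (S n) (β n) (v n) (X n) (y n))
    (Z : ∀ n, Ω n → Matrix (Fin n) (Fin (p n)) ℝ)
    (hZ : (∀ n ω, Z n ω = X n ω) ∨ (∀ n ω, Z n ω = SPAC.standardize (X n ω)))
    (dhat : ∀ n, Ω n → Fin (p n) → ℝ)
    -- tuning parameter and minimal signal
    (lam l : ℕ → ℝ) (hlam : ∀ n, 0 ≤ lam n) (hl : ∀ n, 0 < l n)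
    (hlmin : ∀ n (j : Fin (p n)), (j : ℕ) < q n → l n ≤ |SPAC.spac (S n) j|)
    -- regularity conditions
    (hirr : SPAC.StrongIrrepresentable q S)
    (heig : SPAC.EigenvaluesBounded S)
    (hprec : SPAC.PrecisionAccurate μ S dhat)
    -- rate conditions
    (κ : ℝ) (hκ : 0 ≤ κ)
    (hp_rate : (fun n => (p n : ℝ)) =O[atTop] fun n : ℕ => (n : ℝ) ^ κ)
    (hq_rate : (fun n => (q n : ℝ)) =o[atTop] fun n : ℕ => ((n : ℝ) / Real.log n) ^ (1 / 3 : ℝ))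
    (hlam_lower : (fun n : ℕ => Real.sqrt (q n * n * Real.log n)) =o[atTop] lam)
    (hlam_upper : (fun n : ℕ => Real.sqrt (q n) * lam n / n) =o[atTop] fun _ => (1 : ℝ))
    (hl_rate : (fun n : ℕ => Real.sqrt (q n) * lam n / n) =o[atTop] l) :
    ∃ K₀ : ℝ, 0 < K₀ ∧ ∀ δ : ℝ, 0 < δ →
      SPAC.HoldsWithRate μ δ fun n ω =>
        (∃ g, SPAC.IsLassoSolution (lam n) (dhat n ω) (Z n ω) (y n ω) g) ∧
        ∀ g, SPAC.IsLassoSolution (lam n) (dhat n ω) (Z n ω) (y n ω) g →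
          SPAC.l2norm (g - SPAC.spac (S n)) ≤ K₀ * (Real.sqrt (q n) * lam n / n) ∧
          SPAC.l2norm (SPAC.betaOf (dhat n ω) g - β n) ≤ K₀ * (Real.sqrt (q n) * lam n / n) ∧
          ∀ j, Real.sign (g j) = Real.sign (SPAC.spac (S n) j) := by
  open SPAC in
  obtain ⟨c₁, c₂, hc, hcc, hS⟩ := heig.exists_formBounds
  obtain ⟨η, hη, hirr⟩ := hirr
  have hpd : ∀ n, (S n).PosDef := fun n => (hS n).posDef hc
  have hK := restrictedConst_pos hc
  -- The constant is fixed before `δ` and depends on the eigenvalue bounds only. A larger `δ` merely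
  -- enlarges `M` below, which the vanishing rates absorb.
  refine ⟨errorConst c₁ c₂, by unfold errorConst; positivity, fun δ hδ => ?_⟩
  obtain ⟨M₁, hM₁, hprec⟩ := hprec δ hδ
  set B := Real.sqrt (1 / c₁) with hB
  set K := restrictedConst c₁ with hKdef
  have hden : 0 < 2 + K + B * K + 2 * B := by positivity
  obtain ⟨ε, hε0, hε1, hεc, hε⟩ : ∃ ε : ℝ, 0 < ε ∧ ε ≤ 1 / 2 ∧ ε ≤ c₁ / 2 ∧
      ε * (2 + K + B * K + 2 * B) < η := by
    refine ⟨min (1 / 2) (min (c₁ / 2) (η / 2 / (2 + K + B * K + 2 * B))), by positivity,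
      min_le_left _ _, (min_le_right _ _).trans (min_le_left _ _), ?_⟩
    refine (mul_le_mul_of_nonneg_right ((min_le_right _ _).trans (min_le_right _ _))
      hden.le).trans_lt ?_
    rw [div_mul_cancel₀ _ hden.ne']
    linarith
  -- Dominates four times the variance of each covariate, which is 1, and of the noise, which is at
  -- most `c₂`.
  set V : ℝ := 4 + 4 * c₂ with hV
  have hV1 : 1 ≤ V := by linarith
  -- Chosen so that the deviation `x = M₂ √(log n / n)` makes the tail exponent `n x² / 16` equal to
  -- `(δ + 2κ) log n`.
  set M₂ : ℝ := 4 * Real.sqrt (δ + 2 * κ) with hM₂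
  have hM₂0 : 0 ≤ M₂ := by positivity
  -- One accuracy `M √(log n / n)` that covers both `d̂` and the moments of either design.
  set M : ℝ := M₁ + 40 * (V * M₂) with hM
  have hM0 : 0 < M := by positivity
  have hp1 : ∀ n, 1 ≤ p n := fun n => (hq n).trans (hqp n)
  refine IsBigO.trans (IsBigO.of_bound 1 ?_)
    ((isBigO_union_bound (δ := δ) hp1 hp_rate).add hprec)
  filter_upwards [eventually_gt_atTop 0,
    eventually_sparsity_mul_rate_le hq_rate (div_pos hε0 hM0),
    eventually_sparsity_mul_rate_le hq_rate
      (by positivity : (0 : ℝ) < 1 / (4 * (V * (M₂ + 1)))),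
    eventually_rate_le_lam hq hlam hlam_lower (div_pos hε0 hM0),
    hl_rate.def (by positivity : 0 < 1 / (4 * K))] with n hn hsmall hsmall₂ hrate hsig
  obtain ⟨hlam0, hrate⟩ := hrate
  have hn0 : (0 : ℝ) < n := Nat.cast_pos.2 hn
  have hlog : 0 ≤ Real.log n := Real.log_natCast_nonneg n
  set r := Real.sqrt (Real.log n / n) with hr
  have hr0 : 0 ≤ r := Real.sqrt_nonneg _
  have hq1 : (1 : ℝ) ≤ q n := Nat.one_le_cast.2 (hq n)
  have hx4 : V * (M₂ * r) ≤ 1 / 4 := by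
    have h1 : r ≤ q n * Real.sqrt (q n) * r :=
      le_mul_of_one_le_left hr0 (one_le_mul_of_one_le_of_one_le hq1 (Real.one_le_sqrt.2 hq1))
    have h2 := h1.trans hsmall₂
    rw [le_div_iff₀ (by positivity)] at h2
    nlinarith [mul_nonneg hr0 (by linarith : 0 ≤ V)]
  have hx0 : 0 ≤ M₂ * r := mul_nonneg hM₂0 hr0
  have hx2 : M₂ * r ≤ 2 := by nlinarith
  have hβ := fun k => (hmodel n).linCov_noiseCoef (hpd n).posSemidef hn k
  have hprob := (hmodel n).measure_not_momentsAccurate_le (V := V) (hpd n).posSemidef hn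
    (fun j => by rw [hvar]; linarith)
    (by linarith [(linCov_noiseCoef_self (hS n) hc hβ).2]) hV1 hx0 hx2
  have hexp : (n : ℝ) * (M₂ * r) ^ 2 / 16 = (δ + 2 * κ) * Real.log n := by
    rw [mul_pow, hr, Real.sq_sqrt (by positivity), hM₂, mul_pow, Real.sq_sqrt (by positivity)]
    field_simp
    ring
  rw [hexp] at hprob
  have hsigK : K * (Real.sqrt (q n) * (lam n / n)) < l n / 2 := by
    rw [Real.norm_of_nonneg (by positivity), Real.norm_of_nonneg (hl n).le, one_div_mul_eq_div,
      le_div_iff₀ (by positivity)] at hsig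
    rw [← mul_div_assoc]
    linarith [hl n]
  have hMr : 40 * (V * (M₂ * r)) ≤ M * r := by
    have := mul_nonneg hM₁.le hr0
    rw [hM]
    linarith
  have hM₁r : M₁ * r ≤ M * r := by
    refine mul_le_mul_of_nonneg_right ?_ hr0
    rw [hM]
    have : 0 ≤ V * M₂ := by positivity
    linarith
  have hsub : ∀ ω, MomentsAccurate (covX (S n)) (β n) (X n ω) (y n ω) (V * (M₂ * r)) →
      (∀ i, |dhat n ω i - precDiag (S n) i| ≤ M₁ * r) →
      (∃ g, IsLassoSolution (lam n) (dhat n ω) (Z n ω) (y n ω) g) ∧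
        ∀ g, IsLassoSolution (lam n) (dhat n ω) (Z n ω) (y n ω) g →
          l2norm (g - spac (S n)) ≤ errorConst c₁ c₂ * (Real.sqrt (q n) * lam n / n) ∧
          l2norm (betaOf (dhat n ω) g - β n) ≤
            errorConst c₁ c₂ * (Real.sqrt (q n) * lam n / n) ∧
          ∀ j, Real.sign (g j) = Real.sign (spac (S n) j) := by
    intro ω hmom hd
    obtain ⟨t, ht, hG, hh⟩ := hmom.exists_scale hn (by positivity) hx4 (hvar n)
      (abs_covX_le_one (hpd n) (hvar n)) (hZ.imp (fun h => h n ω) fun h => h n ω)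
    obtain ⟨g, hg, hall⟩ := exists_unique_lassoSolution (a := M * r) hn (hq n) (hqp n) (hS n) hc
      (hvar n) hβ (hsparse n) hη (hirr n) (hlmin n) (by positivity)
      (fun j => (ht j).trans hMr) (fun j k => (hG j k).trans hMr) (fun j => (hh j).trans hMr)
      (fun j => (hd j).trans hM₁r) hlam0 hε1 hεc hε
      (by rw [le_div_iff₀ hM0] at hsmall; linarith)
      (by
        have := mul_le_mul_of_nonneg_left hrate hM0.le
        rw [← mul_assoc M (ε / M), mul_div_cancel₀ _ hM0.ne'] at this
        linarith)
      hsigK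
    refine ⟨⟨g, hg⟩, fun g' hg' => ?_⟩
    rw [mul_div_assoc]
    exact hall g' hg'
  rw [one_mul, Real.norm_of_nonneg measureReal_nonneg, Real.norm_of_nonneg (by positivity)]
  -- Failure implies inaccurate moments or an inaccurate `d̂`. Monotonicity and subadditivity
  -- suffice, so no measurability of the failure event is needed.
  refine le_trans (measureReal_mono ?_) ((measureReal_union_le _ _).trans
    (add_le_add hprob le_rfl))
  intro ω hω
  by_contra hcon
  rw [Set.mem_union, not_or] at hcon
  exact hω (hsub ω (not_not.1 hcon.1) (not_not.1 hcon.2))
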